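/- Let $w$ be a standard Brownian motion, $N$ a Poisson process of intensity $\lambda\ge 0$, and $(Y_j)_{j\ge1}$ i.i.d. random variables with $\mathbf E Y_j=0$, $\mathbf E Y_j^2=1$, $\mathbf E Y_j^4<\infty$, where $w$, $N$ and $(Y_j)$ are independent. For $a\le 0$ and $\varrho_1,\varrho_2\in\mathbb R$, let $\xi$ be the non-Gaussian Ornstein–Uhlenbeck process $$d\xi_t=a\,\xi_t\,dt+du_t,\qquad \xi_0=0,\qquad u_t=\varrho_1w_t+\varrho_2\sum_{j=1}^{N_t}Y_j .$$ For $n>0$ and a bounded left-continuous function $f:[0,\infty)\to\mathbb R$ let $I_n(f)=\int_0^n f(s)\,d\xi_s$ be the stochastic integral, i.e. the limit in probability of the sums $\sum_i f(t_i)(\xi_{t_{i+1}}-\xi_{t_i})$ over partitions of $[0,n]$ with mesh tending to $0$. Put $\tilde I_n(f)=I_n(f)^2-\mathbf E\,I_n(f)^2$, $\|f\|_*=\sup_{0\le t\le n}|f(t)|$, $$\varpi_{f,g}=\max_{0\le v\le n}\ \max_{0\le t\le n-v}\Big|\int_0^t f(u+v)g(u)\,du\Big|,\qquad \varpi^*_{f,g}=\max(\varpi_{f,g},\varpi_{g,f}).$$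 Further set $\varrho^*=\varrho_1^2+\lambda\varrho_2^2$, $\lambda_2=\varrho_1^2\varrho^*+\lambda\varrho_2^2$, $\varrho_3=\lambda\varrho_2^4\,\mathbf E Y_1^4$, $D_1^*=4\lambda\varrho_1^2+7\lambda^2\varrho_2^2$, $D_2^*=4\varrho_1^2\varrho^*+\varrho_2^2D_1^*+23\lambda_2$ and $$M^*=4\varrho_1^2+\varrho_2^2D_1^*+80\lambda_2+12D_2^*+21\varrho_3 .$$ Then, for all bounded left-continuous functions $f,g:[0,\infty)\to\mathbb R$, the integrals $I_n(f)$ and $I_n(g)$ exist and are square integrable, the product $\tilde I_n(f)\tilde I_n(g)$ is integrable, and $$\big|\mathbf E\,\tilde I_n(f)\,\tilde I_n(g)\big|\le n\,M^*\big(\varpi^*_{f,g}+\|f\|_*\|g\|_*\big)\,\|f\|_*\|g\|_* .$$ -/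

import Mathlib

open MeasureTheory ProbabilityTheory Filter Topology
open scoped NNReal ENNReal

noncomputable section

/-- A (homogeneous) Poisson process with intensity `lam ≥ 0` on the probability space `(Ω, P)`:
an `ℕ`-valued process started at `0`, with nondecreasing right-continuous paths, independent
increments, and increments over `(s, t]` that are Poisson with parameter `lam * (t - s)`. -/
structure IsPoissonProcess {Ω : Type*} [MeasurableSpace Ω] (P : Measure Ω) (lam : ℝ≥0)
    (N : ℝ≥0 → Ω → ℕ) : Prop where
  measurable : ∀ t, Measurable (N t)
  start : ∀ᵐ ω ∂P, N 0 ω = 0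
  mono : ∀ᵐ ω ∂P, Monotone (fun t => N t ω)
  rightCont : ∀ᵐ ω ∂P, ∀ t, ContinuousWithinAt (fun s => N s ω) (Set.Ici t) t
  indepIncrements : HasIndepIncrements (fun t ω => (N t ω : ℝ)) P
  law : ∀ s t, s ≤ t → HasLaw (fun ω => N t ω - N s ω) (poissonMeasure (lam * (t - s))) P

/-- The compound process `z_t = ∑_{j ≤ N_t} Y_j` (the marks are indexed from `0`). -/
def compoundSum {Ω : Type*} (N : ℝ≥0 → Ω → ℕ) (Y : ℕ → Ω → ℝ) (t : ℝ≥0) (ω : Ω) : ℝ :=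
  ∑ j ∈ Finset.range (N t ω), Y j ω

/-- `ξ` is the Ornstein-Uhlenbeck noise `dξ_t = a ξ_t dt + du_t`, `ξ_0 = 0`, `a ≤ 0`, driven by
`u_t = ρ₁ w_t + ρ₂ z_t`, where `w` is a standard Brownian motion and `z` is the compound Poisson
process with intensity `lam` and i.i.d. marks `Y` such that `E Y = 0`, `E Y² = 1`, `E Y⁴ < ∞`;
`w`, `N` and `Y` are independent.  The equation is the integral equation, which holds almost
surely for all times simultaneously. -/
structure IsOUNoise {Ω : Type*} [MeasurableSpace Ω] (P : Measure Ω) (a ρ₁ ρ₂ : ℝ) (lam : ℝ≥0)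
    (w : ℝ≥0 → Ω → ℝ) (N : ℝ≥0 → Ω → ℕ) (Y : ℕ → Ω → ℝ) (ξ : ℝ≥0 → Ω → ℝ) : Prop where
  a_nonpos : a ≤ 0
  measurable_w : ∀ t, Measurable (w t)
  brownian : IsBrownianReal w P
  poisson : IsPoissonProcess P lam N
  measurable_Y : ∀ j, Measurable (Y j)
  iIndep_Y : iIndepFun Y P
  identDistrib_Y : ∀ j, IdentDistrib (Y j) (Y 0) P P
  memLp_Y : MemLp (Y 0) 4 P
  mean_Y : ∫ ω, Y 0 ω ∂P = 0
  second_moment_Y : ∫ ω, Y 0 ω ^ 2 ∂P = 1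
  indep_w : IndepFun (fun ω (t : ℝ≥0) => w t ω)
    (fun ω => ((fun t : ℝ≥0 => N t ω), (fun j : ℕ => Y j ω))) P
  indep_N_Y : IndepFun (fun ω (t : ℝ≥0) => N t ω) (fun ω (j : ℕ) => Y j ω) P
  measurable_ξ : ∀ t, Measurable (ξ t)
  equation : ∀ᵐ ω ∂P, ∀ t : ℝ≥0,
    IntervalIntegrable (fun s : ℝ => ξ s.toNNReal ω) volume 0 (t : ℝ) ∧
      ξ t ω = a * (∫ s in (0 : ℝ)..(t : ℝ), ξ s.toNNReal ω)
        + (ρ₁ * w t ω + ρ₂ * compoundSum N Y t ω)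

/-- A finite partition `0 = pt 0 ≤ pt 1 ≤ ⋯ ≤ pt size = T` of `[0, T]` (the values of `pt` after
`size` play no role). -/
structure TimePartition (T : ℝ≥0) where
  size : ℕ
  pt : ℕ → ℝ≥0
  mono : Monotone pt
  pt_zero : pt 0 = 0
  pt_size : pt size = T

/-- The mesh `max_i (pt (i+1) - pt i)` of a partition. -/
def TimePartition.mesh {T : ℝ≥0} (π : TimePartition T) : ℝ≥0 :=
  (Finset.range π.size).sup (fun i => π.pt (i + 1) - π.pt i)

/-- The elementary stochastic integral `∑_i f(t_i) (X_{t_{i+1}} - X_{t_i})`, i.e. the integral with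
respect to `X` of the step function equal to `f(t_i)` on `(t_i, t_{i+1}]`. -/
def elemIntegral {Ω : Type*} (X : ℝ≥0 → Ω → ℝ) (f : ℝ≥0 → ℝ) {T : ℝ≥0} (π : TimePartition T)
    (ω : Ω) : ℝ :=
  ∑ i ∈ Finset.range π.size, f (π.pt i) * (X (π.pt (i + 1)) ω - X (π.pt i) ω)

/-- `J` is (a version of) the stochastic integral `I_T(f) = ∫_0^T f_s dX_s` of a left-continuous
deterministic integrand `f`: the limit in probability of the elementary integrals along every
sequence of partitions of `[0, T]` whose mesh tends to `0`.  It is unique up to null sets. -/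
def IsStochIntegral {Ω : Type*} [MeasurableSpace Ω] (P : Measure Ω) (X : ℝ≥0 → Ω → ℝ)
    (f : ℝ≥0 → ℝ) (T : ℝ≥0) (J : Ω → ℝ) : Prop :=
  AEMeasurable J P ∧
    ∀ π : ℕ → TimePartition T, Tendsto (fun k => (π k).mesh) atTop (𝓝 0) →
      TendstoInMeasure P (fun k => elemIntegral X f (π k)) atTop J

/-- The centered square `Ĩ = I² - E I²`. -/
def centeredSq {Ω : Type*} [MeasurableSpace Ω] (P : Measure Ω) (J : Ω → ℝ) (ω : Ω) : ℝ :=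
  J ω ^ 2 - ∫ ω', J ω' ^ 2 ∂P

/-- The uniform norm `‖f‖_* = sup_{0 ≤ t ≤ n} |f t|`. -/
def starNorm (n : ℝ≥0) (f : ℝ≥0 → ℝ) : ℝ :=
  sSup {x : ℝ | ∃ t : ℝ≥0, t ≤ n ∧ x = |f t|}

/-- `ϖ_{f,g} = max_{0 ≤ v ≤ n} max_{0 ≤ t ≤ n - v} |∫_0^t f(u+v) g(u) du|`. -/
def corr (n : ℝ≥0) (f g : ℝ≥0 → ℝ) : ℝ :=
  sSup {x : ℝ | ∃ v t : ℝ≥0, v + t ≤ n ∧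
    x = |∫ u in (0 : ℝ)..(t : ℝ), f (u.toNNReal + v) * g u.toNNReal|}

/-- `ϖ*_{f,g} = max(ϖ_{f,g}, ϖ_{g,f})`. -/
def corrStar (n : ℝ≥0) (f g : ℝ≥0 → ℝ) : ℝ :=
  max (corr n f g) (corr n g f)

/-- `ϱ* = ρ₁² + λ ρ₂²`. -/
def rhoStar (ρ₁ ρ₂ lam : ℝ) : ℝ := ρ₁ ^ 2 + lam * ρ₂ ^ 2

/-- `λ₂ = ρ₁² ϱ* + λ ρ₂²`. -/
def lamTwo (ρ₁ ρ₂ lam : ℝ) : ℝ := ρ₁ ^ 2 * rhoStar ρ₁ ρ₂ lam + lam * ρ₂ ^ 2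

/-- `D₁* = 4 λ ρ₁² + 7 λ² ρ₂²`. -/
def DOne (ρ₁ ρ₂ lam : ℝ) : ℝ := 4 * lam * ρ₁ ^ 2 + 7 * lam ^ 2 * ρ₂ ^ 2

/-- `D₂* = 4 ρ₁² ϱ* + ρ₂² D₁* + 23 λ₂`. -/
def DTwo (ρ₁ ρ₂ lam : ℝ) : ℝ :=
  4 * ρ₁ ^ 2 * rhoStar ρ₁ ρ₂ lam + ρ₂ ^ 2 * DOne ρ₁ ρ₂ lam + 23 * lamTwo ρ₁ ρ₂ lam

/-- `M* = 4 ρ₁² + ρ₂² D₁* + 80 λ₂ + 12 D₂* + 21 ϱ₃` with `ϱ₃ = λ ρ₂⁴ E Y⁴`; the last argument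
stands for `E Y⁴`. -/
def MStar (ρ₁ ρ₂ lam m₄ : ℝ) : ℝ :=
  4 * ρ₁ ^ 2 + ρ₂ ^ 2 * DOne ρ₁ ρ₂ lam + 80 * lamTwo ρ₁ ρ₂ lam + 12 * DTwo ρ₁ ρ₂ lam
    + 21 * (lam * ρ₂ ^ 4 * m₄)

end

/-! The integral against `ξ` is an integral against the driving noise `u`. Summation by parts and
Fubini give `I_n(f) = ∫ F du`, where `F(s) = f(s) + a ∫_s^n e^{a(r-s)} f(r) dr` solves `F = f + a
∫_s^n F` (`tendsto_elementary_sum_sub`, `IsOUNoise.isStochIntegral_iff`).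

Sums of weighted increments of `u` have explicit moments. With variance rate `q = ϱ*` and fourth
cumulant rate `κ = ϱ₃`, the second moment is `q ∫ F²` and the fourth is `3 (q ∫ F²)² + κ ∫ F⁴`
(`IsOUNoise.hasStepMoments`). The Brownian part contributes no fourth cumulant; for the compound
Poisson part one integrates out the marks with the counts frozen, then the counts. These formulas
make the elementary sums Cauchy in `L⁴` and pass to the limit.

Polarising the fourth moment yields the exact covariance `E Ĩ(f) Ĩ(g) = 2 q² (∫ F G)² + κ ∫ F² G²`
(`IsL4Integral.integral_sq_mul_sq`, `integral_centeredSq_mul`).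

It remains to estimate. Since `a ≤ 0`, the kernel `|a| e^{ax}` has mass at most `1`, so `|F| ≤ 2
‖f‖_*` and `|∫ F G| ≤ 8 ϖ*` (`abs_integral_volterra_mul_volterra_le`), uniformly in `a`. In `(∫ F
G)²` one factor is bounded by `8 ϖ*` and the other by `4 n ‖f‖_* ‖g‖_*`, so that only one power of
`n` appears. The resulting constants `64 q²` and `16 κ` lie below `M*` (`le_MStar`). -/

/-! ### Moments of independent sums, of the Gaussian law and of the Poisson law. -/

section Moments

variable {Ω : Type*} [MeasurableSpace Ω] {P : Measure Ω} [IsProbabilityMeasure P]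

lemma MeasureTheory.MemLp.integrable_pow_le {X : Ω → ℝ} (hX : MemLp X 4 P) {k : ℕ} (hk : k ≤ 4) :
    Integrable (fun ω => X ω ^ k) P := by
  have h : MemLp X (k : ℝ≥0∞) P := hX.mono_exponent (by exact_mod_cast hk)
  rcases Nat.eq_zero_or_pos k with rfl | hk0
  · simp
  · refine (integrable_norm_iff (hX.1.pow k)).1 ?_
    simpa using h.integrable_norm_pow hk0.ne'

/-- Every cross term with an odd power contains a first moment of `X` or `Y` and vanishes, which
leaves only the term `6 E X² E Y²`. -/
lemma indepFun_moments_add {X Y : Ω → ℝ} (hX : MemLp X 4 P) (hY : MemLp Y 4 P)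
    (hXY : IndepFun X Y P) (hX0 : ∫ ω, X ω ∂P = 0) (hY0 : ∫ ω, Y ω ∂P = 0) :
    ∫ ω, (X ω + Y ω) ^ 2 ∂P = ∫ ω, X ω ^ 2 ∂P + ∫ ω, Y ω ^ 2 ∂P ∧
    ∫ ω, (X ω + Y ω) ^ 4 ∂P = ∫ ω, X ω ^ 4 ∂P
      + 6 * (∫ ω, X ω ^ 2 ∂P) * (∫ ω, Y ω ^ 2 ∂P) + ∫ ω, Y ω ^ 4 ∂P := by
  have hI : ∀ j k : ℕ, j ≤ 4 → k ≤ 4 → Integrable (fun ω => X ω ^ j * Y ω ^ k) P ∧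
      ∫ ω, X ω ^ j * Y ω ^ k ∂P = (∫ ω, X ω ^ j ∂P) * ∫ ω, Y ω ^ k ∂P := by
    intro j k hj hk
    have hi : IndepFun (fun ω => X ω ^ j) (fun ω => Y ω ^ k) P :=
      hXY.comp (φ := fun x : ℝ => x ^ j) (ψ := fun x : ℝ => x ^ k) (by fun_prop) (by fun_prop)
    exact ⟨hi.integrable_mul (hX.integrable_pow_le hj) (hY.integrable_pow_le hk),
      hi.integral_fun_mul_eq_mul_integral (hX.1.pow j) (hY.1.pow k)⟩
  have e11 := hI 1 1 (by norm_num) (by norm_num)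
  have e31 := hI 3 1 (by norm_num) (by norm_num)
  have e22 := hI 2 2 (by norm_num) (by norm_num)
  have e13 := hI 1 3 (by norm_num) (by norm_num)
  simp only [pow_one, hX0, hY0, mul_zero, zero_mul] at e11 e31 e13
  have x2 := hX.integrable_pow_le (k := 2) (by norm_num)
  have x4 := hX.integrable_pow_le (k := 4) (by norm_num)
  have y2 := hY.integrable_pow_le (k := 2) (by norm_num)
  have y4 := hY.integrable_pow_le (k := 4) (by norm_num)
  constructor
  · have : ∀ ω, (X ω + Y ω) ^ 2 = X ω ^ 2 + 2 * (X ω * Y ω) + Y ω ^ 2 := fun ω => by ring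
    simp_rw [this]
    have i1 : Integrable (fun ω => X ω ^ 2 + 2 * (X ω * Y ω)) P := x2.add (e11.1.const_mul 2)
    rw [integral_add i1 y2, integral_add x2 (e11.1.const_mul 2),
      integral_const_mul, e11.2]
    ring
  · have : ∀ ω, (X ω + Y ω) ^ 4 = X ω ^ 4 + 4 * (X ω ^ 3 * Y ω) + 6 * (X ω ^ 2 * Y ω ^ 2)
        + 4 * (X ω * Y ω ^ 3) + Y ω ^ 4 := fun ω => by ring
    simp_rw [this]
    have i1 : Integrable (fun ω => X ω ^ 4 + 4 * (X ω ^ 3 * Y ω)) P := x4.add (e31.1.const_mul 4)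
    have i2 : Integrable (fun ω => X ω ^ 4 + 4 * (X ω ^ 3 * Y ω) + 6 * (X ω ^ 2 * Y ω ^ 2)) P :=
      i1.add (e22.1.const_mul 6)
    have i3 : Integrable (fun ω => X ω ^ 4 + 4 * (X ω ^ 3 * Y ω) + 6 * (X ω ^ 2 * Y ω ^ 2)
      + 4 * (X ω * Y ω ^ 3)) P := i2.add (e13.1.const_mul 4)
    rw [integral_add i3 y4, integral_add i2 (e13.1.const_mul 4), integral_add i1 (e22.1.const_mul 6),
      integral_add x4 (e31.1.const_mul 4),
      integral_const_mul, integral_const_mul, integral_const_mul, e31.2, e22.2, e13.2]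
    ring

/-- Additivity of the fourth cumulant `E X⁴ - 3 (E X²)²` over independent centred variables. -/
lemma iIndepFun_moments_sum {ι : Type*} {X : ι → Ω → ℝ} (hind : iIndepFun X P)
    (hm : ∀ i, Measurable (X i)) (hX : ∀ i, MemLp (X i) 4 P) (h0 : ∀ i, ∫ ω, X i ω ∂P = 0)
    (s : Finset ι) :
    MemLp (fun ω => ∑ i ∈ s, X i ω) 4 P ∧ ∫ ω, ∑ i ∈ s, X i ω ∂P = 0 ∧
    ∫ ω, (∑ i ∈ s, X i ω) ^ 2 ∂P = ∑ i ∈ s, ∫ ω, X i ω ^ 2 ∂P ∧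
    ∫ ω, (∑ i ∈ s, X i ω) ^ 4 ∂P = 3 * (∑ i ∈ s, ∫ ω, X i ω ^ 2 ∂P) ^ 2
      + ∑ i ∈ s, (∫ ω, X i ω ^ 4 ∂P - 3 * (∫ ω, X i ω ^ 2 ∂P) ^ 2) := by
  classical
  induction s using Finset.induction_on with
  | empty => simp
  | insert i s his ih =>
    obtain ⟨ih1, ih2, ih3, ih4⟩ := ih
    have hi : IndepFun (X i) (fun ω => ∑ j ∈ s, X j ω) P := by
      have := (hind.indepFun_finsetSum_of_notMem hm his).symm
      convert this using 1
      ext ω; simp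
    simp only [Finset.sum_insert his]
    have h := indepFun_moments_add (hX i) ih1 hi (h0 i) ih2
    refine ⟨(hX i).add ih1, ?_, ?_, ?_⟩
    · rw [integral_add ((hX i).integrable (by norm_num)) (ih1.integrable (by norm_num)), h0, ih2,
        add_zero]
    · rw [h.1, ih3]
    · rw [h.2, ih3, ih4]; ring

/-- Two independent copies add up to `√2` times one copy in law. Comparing fourth moments gives `4 m
= 2 m + 6 v²`, hence `m = 3 v²`. -/
lemma integral_pow_four_gaussianReal (v : ℝ≥0) : ∫ x, x ^ 4 ∂(gaussianReal 0 v) = 3 * (v : ℝ) ^ 2 := by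
  set μ := gaussianReal 0 v with hμ
  have hid : MemLp (fun x : ℝ => x) 4 μ := memLp_id_gaussianReal' 4 (by norm_num)
  have hmean : ∫ x, x ∂μ = 0 := integral_id_gaussianReal
  have hvar : ∫ x, x ^ 2 ∂μ = v := by
    have := variance_fun_id_gaussianReal (μ := 0) (v := v)
    rwa [variance_of_integral_eq_zero (by fun_prop) hmean] at this
  have hX : MemLp (fun p : ℝ × ℝ => p.1) 4 (μ.prod μ) := hid.comp_fst μ
  have hY : MemLp (fun p : ℝ × ℝ => p.2) 4 (μ.prod μ) := hid.comp_snd μ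
  have hind : IndepFun (fun p : ℝ × ℝ => p.1) (fun p : ℝ × ℝ => p.2) (μ.prod μ) :=
    indepFun_prod (X := id) (Y := id) measurable_id measurable_id
  have hfst : ∀ k : ℕ, ∫ p : ℝ × ℝ, p.1 ^ k ∂(μ.prod μ) = ∫ x, x ^ k ∂μ := fun k => by
    rw [integral_fun_fst (fun x : ℝ => x ^ k)]; simp
  have hsnd : ∀ k : ℕ, ∫ p : ℝ × ℝ, p.2 ^ k ∂(μ.prod μ) = ∫ x, x ^ k ∂μ := fun k => by
    rw [integral_fun_snd (fun x : ℝ => x ^ k)]; simp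
  have h := (indepFun_moments_add hX hY hind (by simpa [hmean] using hfst 1)
    (by simpa [hmean] using hsnd 1)).2
  rw [hfst, hfst, hsnd, hsnd, hvar] at h
  have hsum : ∫ p : ℝ × ℝ, (p.1 + p.2) ^ 4 ∂(μ.prod μ) = 4 * ∫ x, x ^ 4 ∂μ := by
    have h1 : (μ.prod μ).map (fun p : ℝ × ℝ => p.1 + p.2) = μ.map (fun x => √2 * x) := by
      rw [hμ, gaussianReal_map_const_mul]
      have := gaussianReal_conv_gaussianReal (m₁ := 0) (m₂ := 0) (v₁ := v) (v₂ := v)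
      rw [Measure.conv] at this
      rw [this]
      congr 1
      · simp
      · ext; simp [two_mul]
    have h2 : ∫ p : ℝ × ℝ, (p.1 + p.2) ^ 4 ∂(μ.prod μ)
        = ∫ y, y ^ 4 ∂((μ.prod μ).map (fun p : ℝ × ℝ => p.1 + p.2)) := by
      rw [integral_map (by fun_prop) (by fun_prop)]
    rw [h2, h1, integral_map (by fun_prop) (by fun_prop)]
    simp_rw [mul_pow]
    rw [integral_const_mul]
    congr 1
    rw [show (4 : ℕ) = 2 * 2 from rfl, pow_mul, Real.sq_sqrt (by norm_num)]; norm_num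
  linarith

lemma poissonMeasure_moments (r : ℝ≥0) :
    MemLp (fun n : ℕ => (n : ℝ)) 2 (poissonMeasure r) ∧
    ∫ n, (n : ℝ) ∂(poissonMeasure r) = r ∧
    ∫ n, (n : ℝ) ^ 2 ∂(poissonMeasure r) = (r : ℝ) ^ 2 + r := by
  have hs0 := hasSum_one_poissonMeasure r
  have hs1 : HasSum (fun n : ℕ => Real.exp (-r) * r ^ n / (n.factorial) * (n : ℝ)) r := by
    -- Dropping the zero term and shifting the index turns `(n + 1) r^(n+1) / (n+1)!` into `r · r^n
    -- / n!`, reducing each moment to lower ones.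
    rw [← hasSum_nat_add_iff' 1]
    simp only [Finset.range_one, Finset.sum_singleton, Nat.cast_zero, mul_zero, sub_zero]
    have := hs0.mul_left (r : ℝ)
    rw [mul_one] at this
    refine this.congr_fun ?_
    intro n
    rw [Nat.factorial_succ]; push_cast
    have : (n.factorial : ℝ) ≠ 0 := by positivity
    field_simp
    ring
  have hs2 : HasSum (fun n : ℕ => Real.exp (-r) * r ^ n / (n.factorial) * (n : ℝ) ^ 2)
      ((r : ℝ) ^ 2 + r) := by
    rw [← hasSum_nat_add_iff' 1]
    simp only [Finset.range_one, Finset.sum_singleton, Nat.cast_zero]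
    have := (hs1.mul_left (r : ℝ)).add (hs0.mul_left (r : ℝ))
    have e : (r : ℝ) * r + r * 1 = (r : ℝ) ^ 2 + r
        - Real.exp (-r) * r ^ 0 / (Nat.factorial 0) * 0 ^ 2 := by simp; ring
    rw [e] at this
    refine this.congr_fun ?_
    intro n
    rw [Nat.factorial_succ]; push_cast
    have : (n.factorial : ℝ) ≠ 0 := by positivity
    field_simp
    ring
  refine ⟨?_, ?_, ?_⟩
  · rw [memLp_two_iff_integrable_sq (by fun_prop), integrable_poissonMeasure_iff]
    convert hs2.summable using 2 with n
    simp
  · rw [integral_poissonMeasure]; simpa using hs1.tsum_eq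
  · rw [integral_poissonMeasure]; simpa using hs2.tsum_eq

end Moments

/-- The sums `∑_{i<M} c_i (u_{t_{i+1}} - u_{t_i})` over monotone times have the second and fourth
moments of a centred process with independent stationary increments, variance rate `q` and fourth
cumulant rate `κ`. -/
structure HasStepMoments {Ω : Type*} [MeasurableSpace Ω] (P : Measure Ω) (u : ℝ≥0 → Ω → ℝ)
    (q κ : ℝ) : Prop where
  memLp : ∀ (t : ℕ → ℝ≥0) (c : ℕ → ℝ) (M : ℕ), Monotone t →
    MemLp (fun ω => ∑ i ∈ Finset.range M, c i * (u (t (i + 1)) ω - u (t i) ω)) 4 P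
  mean : ∀ (t : ℕ → ℝ≥0) (c : ℕ → ℝ) (M : ℕ), Monotone t →
    ∫ ω, ∑ i ∈ Finset.range M, c i * (u (t (i + 1)) ω - u (t i) ω) ∂P = 0
  two : ∀ (t : ℕ → ℝ≥0) (c : ℕ → ℝ) (M : ℕ), Monotone t →
    ∫ ω, (∑ i ∈ Finset.range M, c i * (u (t (i + 1)) ω - u (t i) ω)) ^ 2 ∂P
      = q * ∑ i ∈ Finset.range M, c i ^ 2 * ((t (i + 1) : ℝ) - t i)
  four : ∀ (t : ℕ → ℝ≥0) (c : ℕ → ℝ) (M : ℕ), Monotone t →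
    ∫ ω, (∑ i ∈ Finset.range M, c i * (u (t (i + 1)) ω - u (t i) ω)) ^ 4 ∂P
      = 3 * (q * ∑ i ∈ Finset.range M, c i ^ 2 * ((t (i + 1) : ℝ) - t i)) ^ 2
        + κ * ∑ i ∈ Finset.range M, c i ^ 4 * ((t (i + 1) : ℝ) - t i)

/-! ### Moments of Brownian increments, of marks with frozen counts, and of Poisson counts. -/

section

variable {Ω : Type*} [MeasurableSpace Ω] {P : Measure Ω} [IsProbabilityMeasure P]

lemma memLp_four_of_integrable {Ω : Type*} [MeasurableSpace Ω] {P : Measure Ω} {X : Ω → ℝ}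
    (hX : AEStronglyMeasurable X P) (h : Integrable (fun ω => X ω ^ 4) P) : MemLp X 4 P := by
  rw [← integrable_norm_rpow_iff hX (by norm_num) (by norm_num)]
  refine h.congr (Eventually.of_forall fun ω => ?_)
  have : ((4 : ℝ≥0∞).toReal) = (4 : ℕ) := by simp
  simp only [this, Real.rpow_natCast, Real.norm_eq_abs]
  exact (Even.pow_abs (by decide) _).symm

/-- The cumulant rate is `0` because a Gaussian fourth moment is exactly three times the squared
variance. -/
lemma ProbabilityTheory.IsBrownianReal.hasStepMoments {w : ℝ≥0 → Ω → ℝ} (hw : IsBrownianReal w P)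
    (hm : ∀ t, Measurable (w t)) : HasStepMoments P w 1 0 := by
  have hpre : IsPreBrownianReal w P := hw.toIsPreBrownianReal
  have key : ∀ (t : ℕ → ℝ≥0) (c : ℕ → ℝ) (M : ℕ), Monotone t → _ := fun t c M ht => by
    have hind : iIndepFun (fun i ω => c i * (w (t (i + 1)) ω - w (t i) ω)) P :=
      (hpre.hasIndepIncrements.nat ht).comp (fun i x => c i * x) (fun i => by fun_prop)
    have hlaw : ∀ i, HasLaw (w (t (i + 1)) - w (t i)) (gaussianReal 0 (t (i + 1) - t i)) P := by
      intro i
      have := hpre.hasLaw_sub (t (i + 1)) (t i)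
      convert this using 2
      ext
      rw [coe_nndist, Real.dist_eq, NNReal.coe_sub (ht i.le_succ), abs_of_nonneg]
      rfl
      exact sub_nonneg.2 (by exact_mod_cast ht i.le_succ)
    have hint : ∀ i k, ∫ ω, (c i * (w (t (i + 1)) ω - w (t i) ω)) ^ k ∂P
        = c i ^ k * ∫ x, x ^ k ∂(gaussianReal 0 (t (i + 1) - t i)) := by
      intro i k
      simp_rw [mul_pow]
      rw [integral_const_mul]
      congr 1
      exact (hlaw i).integral_comp (f := fun x : ℝ => x ^ k) (by fun_prop)
    have hLp : ∀ i, MemLp (fun ω => c i * (w (t (i + 1)) ω - w (t i) ω)) 4 P := by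
      intro i
      refine MemLp.const_mul ?_ _
      have h1 : MemLp id 4 (P.map (w (t (i + 1)) - w (t i))) := by
        rw [(hlaw i).map_eq]; exact memLp_id_gaussianReal' 4 (by norm_num)
      exact (memLp_map_measure_iff (by fun_prop) (hlaw i).aemeasurable).1 h1
    have h0 : ∀ i, ∫ ω, c i * (w (t (i + 1)) ω - w (t i) ω) ∂P = 0 := by
      intro i
      have := hint i 1
      simpa [integral_id_gaussianReal] using this
    have h2 : ∀ i, ∫ ω, (c i * (w (t (i + 1)) ω - w (t i) ω)) ^ 2 ∂P
        = c i ^ 2 * ((t (i + 1) : ℝ) - t i) := by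
      intro i
      have hvar := variance_fun_id_gaussianReal (μ := 0) (v := t (i + 1) - t i)
      rw [variance_of_integral_eq_zero (by fun_prop) integral_id_gaussianReal] at hvar
      rw [hint, hvar, NNReal.coe_sub (ht i.le_succ)]
    have h4 : ∀ i, ∫ ω, (c i * (w (t (i + 1)) ω - w (t i) ω)) ^ 4 ∂P
        = c i ^ 4 * (3 * ((t (i + 1) : ℝ) - t i) ^ 2) := by
      intro i
      rw [hint, integral_pow_four_gaussianReal, NNReal.coe_sub (ht i.le_succ)]
    have hmeas : ∀ i, Measurable (fun ω => c i * (w (t (i + 1)) ω - w (t i) ω)) := fun i => by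
      fun_prop
    have := iIndepFun_moments_sum hind hmeas hLp h0 (Finset.range M)
    simp only [h2, h4] at this
    exact this
  refine ⟨fun t c M ht => (key t c M ht).1, fun t c M ht => (key t c M ht).2.1,
    fun t c M ht => ?_, fun t c M ht => ?_⟩
  · rw [(key t c M ht).2.2.1, one_mul]
  · rw [(key t c M ht).2.2.2, one_mul, zero_mul]
    congr 1
    refine Finset.sum_eq_zero fun i _ => ?_
    ring

/-- One sequence `b`, constant on each block `[n i, n (i + 1))`, has to serve every `ψ` at once: the
same `b` rewrites both the weighted sum of marks and the sums of powers of the weights. -/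
lemma exists_block_coefficients (n : ℕ → ℕ) (hn : Monotone n) (c : ℕ → ℝ) (M : ℕ) :
    ∃ b : ℕ → ℝ, ∀ ψ : ℝ → ℕ → ℝ,
      ∑ i ∈ Finset.range M, ∑ j ∈ Finset.Ico (n i) (n (i + 1)), ψ (c i) j
        = ∑ j ∈ Finset.Ico (n 0) (n M), ψ (b j) j := by
  induction M with
  | zero => exact ⟨fun _ => 0, fun ψ => by simp⟩
  | succ M ih =>
    obtain ⟨b, hb⟩ := ih
    refine ⟨fun j => if j < n M then b j else c M, fun ψ => ?_⟩
    rw [Finset.sum_range_succ, hb,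
      ← Finset.sum_Ico_consecutive _ (hn (Nat.zero_le M)) (hn M.le_succ)]
    congr 1
    · refine Finset.sum_congr rfl fun j hj => ?_
      simp [(Finset.mem_Ico.1 hj).2]
    · refine Finset.sum_congr rfl fun j hj => ?_
      simp [not_lt.2 (Finset.mem_Ico.1 hj).1]

/-- The conditional moments of the compound sums given the counts: for deterministic counts `n`, the
block sums are one independent sum `∑ b j * Y j`, whose fourth cumulant is `(E Y⁴ - 3) ∑ b j ^ 4`.
-/
lemma iid_block_sum_moments {Y : ℕ → Ω → ℝ} (hm : ∀ j, Measurable (Y j)) (hind : iIndepFun Y P)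
    (hid : ∀ j, IdentDistrib (Y j) (Y 0) P P) (hLp : MemLp (Y 0) 4 P)
    (h0 : ∫ ω, Y 0 ω ∂P = 0) (h2 : ∫ ω, Y 0 ω ^ 2 ∂P = 1)
    (n : ℕ → ℕ) (hn : Monotone n) (c : ℕ → ℝ) (M : ℕ) :
    MemLp (fun ω => ∑ i ∈ Finset.range M, c i *
      (∑ j ∈ Finset.range (n (i + 1)), Y j ω - ∑ j ∈ Finset.range (n i), Y j ω)) 4 P ∧
    ∫ ω, ∑ i ∈ Finset.range M, c i *
      (∑ j ∈ Finset.range (n (i + 1)), Y j ω - ∑ j ∈ Finset.range (n i), Y j ω) ∂P = 0 ∧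
    ∫ ω, (∑ i ∈ Finset.range M, c i *
      (∑ j ∈ Finset.range (n (i + 1)), Y j ω - ∑ j ∈ Finset.range (n i), Y j ω)) ^ 2 ∂P
      = ∑ i ∈ Finset.range M, c i ^ 2 * ((n (i + 1) : ℝ) - n i) ∧
    ∫ ω, (∑ i ∈ Finset.range M, c i *
      (∑ j ∈ Finset.range (n (i + 1)), Y j ω - ∑ j ∈ Finset.range (n i), Y j ω)) ^ 4 ∂P
      = 3 * (∑ i ∈ Finset.range M, c i ^ 2 * ((n (i + 1) : ℝ) - n i)) ^ 2
        + (∫ ω, Y 0 ω ^ 4 ∂P - 3) * ∑ i ∈ Finset.range M, c i ^ 4 * ((n (i + 1) : ℝ) - n i) := by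
  obtain ⟨b, hb⟩ := exists_block_coefficients n hn c M
  have hsum : ∀ ω, ∑ i ∈ Finset.range M, c i *
      (∑ j ∈ Finset.range (n (i + 1)), Y j ω - ∑ j ∈ Finset.range (n i), Y j ω)
      = ∑ j ∈ Finset.Ico (n 0) (n M), b j * Y j ω := by
    intro ω
    rw [← hb (fun x j => x * Y j ω)]
    refine Finset.sum_congr rfl fun i _ => ?_
    rw [← Finset.sum_Ico_eq_sub _ (hn i.le_succ), Finset.mul_sum]
  have hpow : ∀ k, ∑ i ∈ Finset.range M, c i ^ k * ((n (i + 1) : ℝ) - n i)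
      = ∑ j ∈ Finset.Ico (n 0) (n M), b j ^ k := by
    intro k
    rw [← hb (fun x _ => x ^ k)]
    refine Finset.sum_congr rfl fun i _ => ?_
    simp only [Finset.sum_const, Nat.card_Ico, nsmul_eq_mul]
    rw [Nat.cast_sub (hn i.le_succ)]; ring
  have hYk : ∀ j (k : ℕ), ∫ ω, (b j * Y j ω) ^ k ∂P = b j ^ k * ∫ ω, Y 0 ω ^ k ∂P := by
    intro j k
    simp_rw [mul_pow]
    rw [integral_const_mul]
    congr 1
    exact ((hid j).comp (u := fun x : ℝ => x ^ k) (by fun_prop)).integral_eq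
  have hX := iIndepFun_moments_sum (X := fun j ω => b j * Y j ω)
    (hind.comp (fun j x => b j * x) (fun j => by fun_prop)) (fun j => by fun_prop)
    (fun j => ((hid j).symm.memLp_iff.1 hLp |>.const_mul (b j)))
    (fun j => by simpa [h0] using hYk j 1) (Finset.Ico (n 0) (n M))
  simp only [hYk, h2] at hX
  simp only [hsum, hpow]
  refine ⟨hX.1, hX.2.1, ?_, ?_⟩
  · rw [hX.2.2.1]; simp
  · rw [hX.2.2.2, Finset.mul_sum]
    congr 1
    · simp
    · refine Finset.sum_congr rfl fun j _ => ?_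
      ring

/-- After the marks are integrated out, the fourth moment is a quadratic polynomial in such weighted
counts, so two moments suffice. -/
lemma IsPoissonProcess.moments {lam : ℝ≥0} {N : ℝ≥0 → Ω → ℕ} (hN : IsPoissonProcess P lam N)
    (t : ℕ → ℝ≥0) (ht : Monotone t) (c : ℕ → ℝ) (M : ℕ) :
    MemLp (fun ω => ∑ i ∈ Finset.range M, c i * ((N (t (i + 1)) ω : ℝ) - N (t i) ω)) 2 P ∧
    ∫ ω, ∑ i ∈ Finset.range M, c i * ((N (t (i + 1)) ω : ℝ) - N (t i) ω) ∂P
      = lam * ∑ i ∈ Finset.range M, c i * ((t (i + 1) : ℝ) - t i) ∧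
    ∫ ω, (∑ i ∈ Finset.range M, c i * ((N (t (i + 1)) ω : ℝ) - N (t i) ω)) ^ 2 ∂P
      = (lam * ∑ i ∈ Finset.range M, c i * ((t (i + 1) : ℝ) - t i)) ^ 2
        + lam * ∑ i ∈ Finset.range M, c i ^ 2 * ((t (i + 1) : ℝ) - t i) := by
  have hNm := hN.measurable
  -- The Poisson law is stated for truncated subtraction in `ℕ`; monotone paths make it agree almost
  -- surely with the real difference.
  have hae : ∀ i, (fun ω => (N (t (i + 1)) ω : ℝ) - N (t i) ω)
      =ᵐ[P] fun ω => ((N (t (i + 1)) ω - N (t i) ω : ℕ) : ℝ) := by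
    intro i
    filter_upwards [hN.mono] with ω hω
    rw [Nat.cast_sub (hω (ht i.le_succ))]
  have hlaw := fun i => hN.law (t i) (t (i + 1)) (ht i.le_succ)
  have hr : ∀ i, ((lam * (t (i + 1) - t i) : ℝ≥0) : ℝ) = lam * ((t (i + 1) : ℝ) - t i) := by
    intro i; rw [NNReal.coe_mul, NNReal.coe_sub (ht i.le_succ)]
  have hLp : ∀ i, MemLp (fun ω => (N (t (i + 1)) ω : ℝ) - N (t i) ω) 2 P := by
    intro i
    refine (memLp_congr_ae (hae i)).2 ?_
    have h1 := (poissonMeasure_moments (lam * (t (i + 1) - t i))).1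
    rw [← (hlaw i).map_eq] at h1
    exact (memLp_map_measure_iff (by fun_prop) (hlaw i).aemeasurable).1 h1
  have hE : ∀ i, ∫ ω, ((N (t (i + 1)) ω : ℝ) - N (t i) ω) ∂P = lam * ((t (i + 1) : ℝ) - t i) := by
    intro i
    have h := (hlaw i).integral_comp (f := fun n : ℕ => (n : ℝ)) (by fun_prop)
    simp only [Function.comp_def] at h
    rw [integral_congr_ae (hae i), h, (poissonMeasure_moments _).2.1, hr]
  have hE2 : ∀ i, ∫ ω, ((N (t (i + 1)) ω : ℝ) - N (t i) ω) ^ 2 ∂P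
      = (lam * ((t (i + 1) : ℝ) - t i)) ^ 2 + lam * ((t (i + 1) : ℝ) - t i) := by
    intro i
    have : (fun ω => ((N (t (i + 1)) ω : ℝ) - N (t i) ω) ^ 2)
      =ᵐ[P] fun ω => ((N (t (i + 1)) ω - N (t i) ω : ℕ) : ℝ) ^ 2 := (hae i).fun_comp (· ^ 2)
    have h := (hlaw i).integral_comp (f := fun n : ℕ => (n : ℝ) ^ 2) (by fun_prop)
    simp only [Function.comp_def] at h
    rw [integral_congr_ae this, h, (poissonMeasure_moments _).2.2, hr]
  set X : ℕ → Ω → ℝ := fun i ω => c i * ((N (t (i + 1)) ω : ℝ) - N (t i) ω) with hXdef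
  have hX : ∀ i, MemLp (X i) 2 P := fun i => (hLp i).const_mul (c i)
  have hind : iIndepFun X P :=
    (hN.indepIncrements.nat ht).comp (fun i x => c i * x) (fun i => by fun_prop)
  have hmean : ∫ ω, ∑ i ∈ Finset.range M, X i ω ∂P
      = lam * ∑ i ∈ Finset.range M, c i * ((t (i + 1) : ℝ) - t i) := by
    rw [integral_finsetSum _ fun i _ => (hX i).integrable (by norm_num), Finset.mul_sum]
    refine Finset.sum_congr rfl fun i _ => ?_
    simp only [hXdef]
    rw [integral_const_mul, hE]; ring
  have hS : MemLp (fun ω => ∑ i ∈ Finset.range M, X i ω) 2 P := memLp_finsetSum _ fun i _ => hX i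
  refine ⟨hS, hmean, ?_⟩
  have hv := IndepFun.variance_sum (s := Finset.range M) (X := X) (fun i _ => hX i)
    (fun i _ j _ hij => hind.indepFun hij)
  have hvi : ∀ i, Var[X i; P] = lam * (c i ^ 2 * ((t (i + 1) : ℝ) - t i)) := by
    intro i
    rw [variance_eq_sub (hX i)]
    simp only [hXdef, Pi.pow_apply, mul_pow]
    rw [integral_const_mul, integral_const_mul, hE, hE2]; ring
  have hfun : (∑ i ∈ Finset.range M, X i) = fun ω => ∑ i ∈ Finset.range M, X i ω := by
    ext ω; simp
  rw [hfun, variance_eq_sub hS, hmean] at hv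
  simp only [Pi.pow_apply, hvi, ← Finset.mul_sum] at hv
  linarith

end

/-! ### The compound Poisson process and the driving noise. -/

section

variable {Ω : Type*} [MeasurableSpace Ω] {P : Measure Ω} [IsProbabilityMeasure P]

lemma measurable_sum_range_prod :
    Measurable (fun p : ℕ × (ℕ → ℝ) => ∑ j ∈ Finset.range p.1, p.2 j) :=
  measurable_from_prod_countable_right fun m => by
    simp only
    fun_prop

/-- Conditioning on the counts is done by Fubini on the product of the laws of counts and marks.
Averaging `3 A² + (m4 - 3) B` with `A = ∑ c² ΔN`, `B = ∑ c⁴ ΔN` produces an extra `3 lam ∑ c⁴ Δt`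
from the variance of `A`, which cancels the `-3`; this is why the cumulant rate is just `lam * m4`.
-/
lemma compoundSum_hasStepMoments {lam : ℝ≥0} {N : ℝ≥0 → Ω → ℕ} {Y : ℕ → Ω → ℝ}
    (hN : IsPoissonProcess P lam N)
    (hm : ∀ j, Measurable (Y j)) (hind : iIndepFun Y P)
    (hid : ∀ j, IdentDistrib (Y j) (Y 0) P P) (hLp : MemLp (Y 0) 4 P)
    (h0 : ∫ ω, Y 0 ω ∂P = 0) (h2 : ∫ ω, Y 0 ω ^ 2 ∂P = 1)
    (hNY : IndepFun (fun ω (t : ℝ≥0) => N t ω) (fun ω (j : ℕ) => Y j ω) P) :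
    HasStepMoments P (compoundSum N Y) lam (lam * ∫ ω, Y 0 ω ^ 4 ∂P) := by
  have hNm := hN.measurable
  set m4 := ∫ ω, Y 0 ω ^ 4 ∂P with hm4
  have key : ∀ (t : ℕ → ℝ≥0) (c : ℕ → ℝ) (M : ℕ), Monotone t →
      MemLp (fun ω => ∑ i ∈ Finset.range M,
        c i * (compoundSum N Y (t (i + 1)) ω - compoundSum N Y (t i) ω)) 4 P ∧
      ∫ ω, ∑ i ∈ Finset.range M,
        c i * (compoundSum N Y (t (i + 1)) ω - compoundSum N Y (t i) ω) ∂P = 0 ∧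
      ∫ ω, (∑ i ∈ Finset.range M,
        c i * (compoundSum N Y (t (i + 1)) ω - compoundSum N Y (t i) ω)) ^ 2 ∂P
        = lam * ∑ i ∈ Finset.range M, c i ^ 2 * ((t (i + 1) : ℝ) - t i) ∧
      ∫ ω, (∑ i ∈ Finset.range M,
        c i * (compoundSum N Y (t (i + 1)) ω - compoundSum N Y (t i) ω)) ^ 4 ∂P
        = 3 * (lam * ∑ i ∈ Finset.range M, c i ^ 2 * ((t (i + 1) : ℝ) - t i)) ^ 2
          + lam * m4 * ∑ i ∈ Finset.range M, c i ^ 4 * ((t (i + 1) : ℝ) - t i) := by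
    intro t c M ht
    set ζ : (ℕ → ℕ) × (ℕ → ℝ) → ℝ := fun p => ∑ i ∈ Finset.range M, c i *
      (∑ j ∈ Finset.range (p.1 (i + 1)), p.2 j - ∑ j ∈ Finset.range (p.1 i), p.2 j) with hζ
    have hζm : Measurable ζ := by
      have h1 : ∀ i : ℕ, Measurable (fun p : (ℕ → ℕ) × (ℕ → ℝ) =>
          ∑ j ∈ Finset.range (p.1 i), p.2 j) := fun i => by
        have h : Measurable (fun p : (ℕ → ℕ) × (ℕ → ℝ) => (p.1 i, p.2)) := by fun_prop
        exact measurable_sum_range_prod.comp h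
      exact Finset.measurable_fun_sum _ fun i _ => ((h1 (i + 1)).sub (h1 i)).const_mul (c i)
    set ν : Ω → ℕ → ℕ := fun ω i => N (t i) ω with hν
    set y : Ω → ℕ → ℝ := fun ω j => Y j ω with hy
    have hνm : Measurable ν := measurable_pi_lambda _ fun i => hNm (t i)
    have hym : Measurable y := measurable_pi_lambda _ hm
    have hνy : IndepFun ν y P :=
      hNY.comp (φ := fun (n : ℝ≥0 → ℕ) i => n (t i)) (ψ := id)
        (measurable_pi_lambda _ fun i => measurable_pi_apply _) measurable_id
    have hprod := (indepFun_iff_map_prod_eq_prod_map_map hνm.aemeasurable hym.aemeasurable).1 hνy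
    have : IsProbabilityMeasure (P.map ν) := Measure.isProbabilityMeasure_map hνm.aemeasurable
    have : IsProbabilityMeasure (P.map y) := Measure.isProbabilityMeasure_map hym.aemeasurable
    -- The fibrewise formulas need monotone counts, so they hold for almost every count sequence
    -- only.
    have hmono : ∀ᵐ n ∂(P.map ν), Monotone n := by
      have hset : MeasurableSet {n : ℕ → ℕ | Monotone n} := by
        have : {n : ℕ → ℕ | Monotone n} = ⋂ i, {n : ℕ → ℕ | n i ≤ n (i + 1)} := by
          ext n
          simp only [Set.mem_ofPred_eq, Set.mem_iInter]
          exact ⟨fun h i => h i.le_succ, monotone_nat_of_le_succ⟩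
        rw [this]
        exact MeasurableSet.iInter fun i =>
          measurableSet_le (measurable_pi_apply i) (measurable_pi_apply (i + 1))
      rw [ae_map_iff hνm.aemeasurable hset]
      filter_upwards [hN.mono] with ω hω
      exact hω.comp ht
    have hin := fun (n : ℕ → ℕ) (hn : Monotone n) =>
      iid_block_sum_moments hm hind hid hLp h0 h2 n hn c M
    have hin_map : ∀ (n : ℕ → ℕ) (k : ℕ), ∫ z, ζ (n, z) ^ k ∂(P.map y) = ∫ ω, ζ (n, y ω) ^ k ∂P :=
      fun n k => integral_map hym.aemeasurable
        ((hζm.comp measurable_prodMk_left).pow_const k).aestronglyMeasurable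
    have hin_int : ∀ (n : ℕ → ℕ) (k : ℕ), Monotone n → k ≤ 4 →
        Integrable (fun z => ζ (n, z) ^ k) (P.map y) := by
      intro n k hn hk
      refine (integrable_map_measure
        ((hζm.comp measurable_prodMk_left).pow_const k).aestronglyMeasurable hym.aemeasurable).2 ?_
      exact (hin n hn).1.integrable_pow_le hk
    have hNmom := fun c' => hN.moments t ht c' M
    have hφ4m : Measurable (fun n : ℕ → ℕ =>
        3 * (∑ i ∈ Finset.range M, c i ^ 2 * ((n (i + 1) : ℝ) - n i)) ^ 2
        + (m4 - 3) * ∑ i ∈ Finset.range M, c i ^ 4 * ((n (i + 1) : ℝ) - n i)) := by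
      fun_prop
    have hφ4i : Integrable (fun ω =>
        3 * (∑ i ∈ Finset.range M, c i ^ 2 * ((N (t (i + 1)) ω : ℝ) - N (t i) ω)) ^ 2
        + (m4 - 3) * ∑ i ∈ Finset.range M, c i ^ 4 * ((N (t (i + 1)) ω : ℝ) - N (t i) ω)) P :=
      ((hNmom (fun i => c i ^ 2)).1.integrable_sq.const_mul 3).add
        (((hNmom (fun i => c i ^ 4)).1.integrable (by norm_num)).const_mul (m4 - 3))
    have hin4 : (fun n => ∫ z, ζ (n, z) ^ 4 ∂(P.map y)) =ᵐ[P.map ν] fun n : ℕ → ℕ =>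
        3 * (∑ i ∈ Finset.range M, c i ^ 2 * ((n (i + 1) : ℝ) - n i)) ^ 2
        + (m4 - 3) * ∑ i ∈ Finset.range M, c i ^ 4 * ((n (i + 1) : ℝ) - n i) := by
      filter_upwards [hmono] with n hn
      rw [hin_map]
      exact (hin n hn).2.2.2
    -- As `ζ ^ 4` is nonnegative, its integrability on the product follows from that of the fibre
    -- integrals, which are known in closed form.
    have hI4 : Integrable (fun p => ζ p ^ 4) ((P.map ν).prod (P.map y)) := by
      rw [integrable_prod_iff (hζm.pow_const 4).aestronglyMeasurable]
      refine ⟨?_, ?_⟩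
      · filter_upwards [hmono] with n hn using hin_int n 4 hn le_rfl
      · have : ∀ p, ‖ζ p ^ 4‖ = ζ p ^ 4 := fun p =>
          Real.norm_of_nonneg ((show Even 4 by decide).pow_nonneg _)
        simp only [this]
        refine (integrable_congr hin4).2 ?_
        exact (integrable_map_measure hφ4m.aestronglyMeasurable hνm.aemeasurable).2 hφ4i
    have hζLp : MemLp ζ 4 ((P.map ν).prod (P.map y)) :=
      memLp_four_of_integrable hζm.aestronglyMeasurable hI4
    have hmap : ∀ k : ℕ, ∫ ω, ζ (ν ω, y ω) ^ k ∂P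
        = ∫ p, ζ p ^ k ∂((P.map ν).prod (P.map y)) := by
      intro k
      rw [← hprod, integral_map (hνm.prodMk hym).aemeasurable
        (hζm.pow_const k).aestronglyMeasurable]
    have hpull : ∀ (φ : (ℕ → ℕ) → ℝ), Measurable φ →
        ∫ n, φ n ∂(P.map ν) = ∫ ω, φ (ν ω) ∂P := fun φ hφ =>
      integral_map hνm.aemeasurable hφ.aestronglyMeasurable
    refine ⟨?_, ?_, ?_, ?_⟩
    · rw [← hprod] at hζLp
      exact (memLp_map_measure_iff hζm.aestronglyMeasurable (hνm.prodMk hym).aemeasurable).1 hζLp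
    · have h := hmap 1
      rw [integral_prod _ (hζLp.integrable_pow_le (by norm_num))] at h
      have hz : (fun n => ∫ z, ζ (n, z) ^ 1 ∂(P.map y)) =ᵐ[P.map ν] fun _ => 0 := by
        filter_upwards [hmono] with n hn
        rw [hin_map]
        simpa using (hin n hn).2.1
      rw [integral_congr_ae hz] at h
      simp only [pow_one, integral_zero] at h
      exact h
    · have h := hmap 2
      rw [integral_prod _ (hζLp.integrable_pow_le (by norm_num))] at h
      have hz : (fun n => ∫ z, ζ (n, z) ^ 2 ∂(P.map y)) =ᵐ[P.map ν] fun n =>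
          ∑ i ∈ Finset.range M, c i ^ 2 * ((n (i + 1) : ℝ) - n i) := by
        filter_upwards [hmono] with n hn
        rw [hin_map]
        exact (hin n hn).2.2.1
      rw [integral_congr_ae hz, hpull _ (by fun_prop)] at h
      exact h.trans (hNmom (fun i => c i ^ 2)).2.1
    · have h := hmap 4
      rw [integral_prod _ hI4, integral_congr_ae hin4, hpull _ hφ4m] at h
      refine h.trans ?_
      simp only [hν]
      rw [integral_add ((hNmom (fun i => c i ^ 2)).1.integrable_sq.const_mul 3)
        (((hNmom (fun i => c i ^ 4)).1.integrable (by norm_num)).const_mul (m4 - 3)),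
        integral_const_mul, integral_const_mul, (hNmom (fun i => c i ^ 2)).2.2,
        (hNmom (fun i => c i ^ 4)).2.1]
      have : ∀ i, (c i ^ 2) ^ 2 = c i ^ 4 := fun i => by ring
      simp only [this]
      ring
  exact ⟨fun t c M ht => (key t c M ht).1, fun t c M ht => (key t c M ht).2.1,
    fun t c M ht => (key t c M ht).2.2.1, fun t c M ht => (key t c M ht).2.2.2⟩

lemma measurable_compoundSum {N : ℝ≥0 → Ω → ℕ} {Y : ℕ → Ω → ℝ} (hN : ∀ t, Measurable (N t))
    (hY : ∀ j, Measurable (Y j)) (t : ℝ≥0) : Measurable (compoundSum N Y t) :=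
  measurable_sum_range_prod.comp ((hN t).prodMk (measurable_pi_lambda _ hY))

/-- The driving noise `u = ρ₁ w + ρ₂ z`. -/
noncomputable def drivingNoise (ρ₁ ρ₂ : ℝ) (w : ℝ≥0 → Ω → ℝ) (N : ℝ≥0 → Ω → ℕ) (Y : ℕ → Ω → ℝ)
    (t : ℝ≥0) (ω : Ω) : ℝ :=
  ρ₁ * w t ω + ρ₂ * compoundSum N Y t ω

/-- The Brownian and compound Poisson parts are independent, so cumulant rates add, scaled by `ρ²`
at order two and by `ρ⁴` at order four. -/
lemma IsOUNoise.hasStepMoments {a ρ₁ ρ₂ : ℝ} {lam : ℝ≥0} {w : ℝ≥0 → Ω → ℝ} {N : ℝ≥0 → Ω → ℕ}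
    {Y : ℕ → Ω → ℝ} {ξ : ℝ≥0 → Ω → ℝ} (h : IsOUNoise P a ρ₁ ρ₂ lam w N Y ξ) :
    HasStepMoments P (drivingNoise ρ₁ ρ₂ w N Y) (ρ₁ ^ 2 + lam * ρ₂ ^ 2)
      (lam * ρ₂ ^ 4 * ∫ ω, Y 0 ω ^ 4 ∂P) := by
  have hW := h.brownian.hasStepMoments h.measurable_w
  have hZ := compoundSum_hasStepMoments h.poisson h.measurable_Y h.iIndep_Y h.identDistrib_Y
    h.memLp_Y h.mean_Y h.second_moment_Y h.indep_N_Y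
  have hsplit : ∀ (t : ℕ → ℝ≥0) (c : ℕ → ℝ) (M : ℕ) (ω : Ω),
      ∑ i ∈ Finset.range M,
        c i * (drivingNoise ρ₁ ρ₂ w N Y (t (i + 1)) ω - drivingNoise ρ₁ ρ₂ w N Y (t i) ω)
      = ρ₁ * (∑ i ∈ Finset.range M, c i * (w (t (i + 1)) ω - w (t i) ω))
        + ρ₂ * (∑ i ∈ Finset.range M,
            c i * (compoundSum N Y (t (i + 1)) ω - compoundSum N Y (t i) ω)) := by
    intro t c M ω
    rw [Finset.mul_sum, Finset.mul_sum, ← Finset.sum_add_distrib]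
    refine Finset.sum_congr rfl fun i _ => ?_
    simp only [drivingNoise]; ring
  have hind : ∀ (t : ℕ → ℝ≥0) (c : ℕ → ℝ) (M : ℕ), IndepFun
      (fun ω => ρ₁ * (∑ i ∈ Finset.range M, c i * (w (t (i + 1)) ω - w (t i) ω)))
      (fun ω => ρ₂ * (∑ i ∈ Finset.range M,
            c i * (compoundSum N Y (t (i + 1)) ω - compoundSum N Y (t i) ω))) P := by
    intro t c M
    have h1 : ∀ s : ℝ≥0, Measurable (fun p : (ℝ≥0 → ℕ) × (ℕ → ℝ) =>
        ∑ j ∈ Finset.range (p.1 s), p.2 j) := fun s => by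
      have h : Measurable (fun p : (ℝ≥0 → ℕ) × (ℕ → ℝ) => (p.1 s, p.2)) := by fun_prop
      exact measurable_sum_range_prod.comp h
    have hφ : Measurable (fun p : ℝ≥0 → ℝ =>
        ρ₁ * (∑ i ∈ Finset.range M, c i * (p (t (i + 1)) - p (t i)))) := by fun_prop
    have hψ : Measurable (fun p : (ℝ≥0 → ℕ) × (ℕ → ℝ) => ρ₂ * (∑ i ∈ Finset.range M,
        c i * (∑ j ∈ Finset.range (p.1 (t (i + 1))), p.2 j
          - ∑ j ∈ Finset.range (p.1 (t i)), p.2 j))) :=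
      (Finset.measurable_fun_sum _ fun i _ =>
        ((h1 (t (i + 1))).sub (h1 (t i))).const_mul (c i)).const_mul ρ₂
    have hI := IndepFun.comp h.indep_w hφ hψ
    simpa only [Function.comp_def, compoundSum] using hI
  have hw0 : ∀ (t : ℕ → ℝ≥0) (c : ℕ → ℝ) (M : ℕ), Monotone t →
      ∫ ω, ρ₁ * (∑ i ∈ Finset.range M, c i * (w (t (i + 1)) ω - w (t i) ω)) ∂P = 0 := by
    intro t c M ht
    rw [integral_const_mul, hW.mean t c M ht, mul_zero]
  have hz0 : ∀ (t : ℕ → ℝ≥0) (c : ℕ → ℝ) (M : ℕ), Monotone t →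
      ∫ ω, ρ₂ * (∑ i ∈ Finset.range M,
        c i * (compoundSum N Y (t (i + 1)) ω - compoundSum N Y (t i) ω)) ∂P = 0 := by
    intro t c M ht
    rw [integral_const_mul, hZ.mean t c M ht, mul_zero]
  have hmom := fun t c M ht => indepFun_moments_add ((hW.memLp t c M ht).const_mul ρ₁)
    ((hZ.memLp t c M ht).const_mul ρ₂) (hind t c M) (hw0 t c M ht) (hz0 t c M ht)
  refine ⟨fun t c M ht => ?_, fun t c M ht => ?_, fun t c M ht => ?_, fun t c M ht => ?_⟩
  · simp only [hsplit]
    exact ((hW.memLp t c M ht).const_mul ρ₁).add ((hZ.memLp t c M ht).const_mul ρ₂)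
  · simp only [hsplit]
    rw [integral_add (((hW.memLp t c M ht).const_mul ρ₁).integrable (by norm_num))
      (((hZ.memLp t c M ht).const_mul ρ₂).integrable (by norm_num)), hw0 t c M ht, hz0 t c M ht,
      add_zero]
  · simp only [hsplit]
    rw [(hmom t c M ht).1]
    simp only [mul_pow]
    rw [integral_const_mul, integral_const_mul, hW.two t c M ht, hZ.two t c M ht]
    ring
  · simp only [hsplit]
    rw [(hmom t c M ht).2]
    simp only [mul_pow]
    rw [integral_const_mul, integral_const_mul, integral_const_mul, integral_const_mul,
      hW.two t c M ht, hZ.two t c M ht, hW.four t c M ht, hZ.four t c M ht]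
    ring

end

/-! ### Increments over arbitrary, possibly overlapping, intervals. -/

lemma Finset.exists_monotone_enumeration (S : Finset ℝ≥0) :
    ∃ σ : ℕ → ℝ≥0, Monotone σ ∧ ∀ s ∈ S, ∃ k, σ k = s := by
  classical
  set e := S.orderEmbOfFin rfl with he
  -- Past the last element the sequence stays at the maximum, so it remains monotone on all of `ℕ`.
  refine ⟨fun k => if h : k < S.card then e ⟨k, h⟩ else S.sup id, ?_, ?_⟩
  · intro i j hij
    simp only
    split_ifs with h1 h2 h2
    · exact e.monotone (by simpa using hij)
    · exact Finset.le_sup (f := id) (S.orderEmbOfFin_mem rfl _)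
    · omega
    · exact le_rfl
  · intro s hs
    have : s ∈ Set.range e := by rw [he, S.range_orderEmbOfFin]; exact hs
    obtain ⟨k, hk⟩ := this
    exact ⟨k, by simp [hk]⟩

/-- The identity is asked for every function `X`, so that it applies with the same `σ`, `d` both to
the paths of `u` and to the functions `s ↦ 1_{t ≤ s}`, whose increments are interval indicators. -/
lemma exists_common_refinement {ι : Type*} [Fintype ι] (A B : ι → ℝ≥0) (hAB : ∀ i, A i ≤ B i)
    (c : ι → ℝ) :
    ∃ (σ : ℕ → ℝ≥0) (d : ℕ → ℝ) (M : ℕ), Monotone σ ∧ ∀ X : ℝ≥0 → ℝ,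
      ∑ i, c i * (X (B i) - X (A i)) = ∑ k ∈ Finset.range M, d k * (X (σ (k + 1)) - X (σ k)) := by
  classical
  obtain ⟨σ, hσ, hS⟩ := (Finset.univ.image A ∪ Finset.univ.image B).exists_monotone_enumeration
  have hpq : ∀ i, ∃ p q : ℕ, p ≤ q ∧ σ p = A i ∧ σ q = B i := by
    intro i
    obtain ⟨p, hp⟩ := hS (A i) (by simp)
    obtain ⟨q, hq⟩ := hS (B i) (by simp)
    rcases le_total p q with h | h
    · exact ⟨p, q, h, hp, hq⟩
    -- If the index found for `B i` is the smaller one, monotonicity forces `A i = B i` and the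
    -- interval is empty.
    · refine ⟨p, p, le_rfl, hp, ?_⟩
      have := hσ h
      rw [hp, hq] at this
      rw [hp]; exact le_antisymm (hAB i) this
  choose p q hpq hp hq using hpq
  set M := Finset.univ.sup q with hM
  have hqM : ∀ i, q i ≤ M := fun i => Finset.le_sup (Finset.mem_univ i)
  refine ⟨σ, fun k => ∑ i, if k ∈ Finset.Ico (p i) (q i) then c i else 0, M, hσ, fun X => ?_⟩
  simp only [Finset.sum_mul]
  rw [Finset.sum_comm]
  refine Finset.sum_congr rfl fun i _ => ?_
  rw [← hp i, ← hq i, ← Finset.sum_Ico_sub (fun k => X (σ k)) (hpq i), Finset.mul_sum]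
  have hsub : Finset.Ico (p i) (q i) ⊆ Finset.range M := fun k hk => by
    have := (Finset.mem_Ico.1 hk).2
    exact Finset.mem_range.2 (this.trans_le (hqM i))
  rw [← Finset.sum_subset hsub]
  · exact Finset.sum_congr rfl fun k hk => by rw [if_pos hk]
  · intro k _ hk
    rw [if_neg hk, zero_mul]

/-- The function `∑ i, c i 1_{(A i, B i]}`. -/
noncomputable def intervalStep {ι : Type*} [Fintype ι] (A B : ι → ℝ≥0) (c : ι → ℝ) (t : ℝ) : ℝ :=
  ∑ i, c i * (Set.Ioc (A i : ℝ) (B i)).indicator (fun _ => 1) t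

lemma indicator_Ioc_eq_sub {x y : ℝ≥0} (hxy : x ≤ y) (t : ℝ) :
    (Set.Ioc (x : ℝ) y).indicator (fun _ => (1 : ℝ)) t
      = (if t ≤ y then 1 else 0) - (if t ≤ x then 1 else 0) := by
  have h : (x : ℝ) ≤ y := by exact_mod_cast hxy
  simp only [Set.indicator_apply, Set.mem_Ioc]
  split_ifs <;> first | (exfalso; grind) | norm_num

/-- At most one of the disjoint intervals contains `t`; `p ≠ 0` is needed where none does. -/
lemma sum_indicator_Ioc_pow (σ : ℕ → ℝ≥0) (hσ : Monotone σ) (d : ℕ → ℝ) (M p : ℕ) (hp : p ≠ 0)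
    (t : ℝ) :
    (∑ k ∈ Finset.range M,
      d k * (Set.Ioc (σ k : ℝ) (σ (k + 1))).indicator (fun _ => (1 : ℝ)) t) ^ p
      = ∑ k ∈ Finset.range M,
        d k ^ p * (Set.Ioc (σ k : ℝ) (σ (k + 1))).indicator (fun _ => (1 : ℝ)) t := by
  classical
  by_cases h : ∃ k ∈ Finset.range M, t ∈ Set.Ioc (σ k : ℝ) (σ (k + 1))
  · obtain ⟨k, hk, ht⟩ := h
    have hother : ∀ j, j ≠ k → t ∉ Set.Ioc (σ j : ℝ) (σ (j + 1)) := by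
      intro j hj hjt
      rcases lt_or_gt_of_ne hj with h | h
      · have h1 : (σ (j + 1) : ℝ) ≤ σ k := by exact_mod_cast hσ h
        linarith [hjt.2, ht.1]
      · have h1 : (σ (k + 1) : ℝ) ≤ σ j := by exact_mod_cast hσ h
        linarith [hjt.1, ht.2]
    rw [Finset.sum_eq_single_of_mem k hk, Finset.sum_eq_single_of_mem k hk]
    · rw [mul_pow, Set.indicator_of_mem ht, one_pow]
    · intro j _ hj; rw [Set.indicator_of_notMem (hother j hj), mul_zero]
    · intro j _ hj; rw [Set.indicator_of_notMem (hother j hj), mul_zero]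
  · push Not at h
    rw [Finset.sum_eq_zero, Finset.sum_eq_zero, zero_pow hp]
    · intro k hk; rw [Set.indicator_of_notMem (h k hk), mul_zero]
    · intro k hk; rw [Set.indicator_of_notMem (h k hk), mul_zero]

lemma integral_sum_indicator_Ioc_pow (σ : ℕ → ℝ≥0) (hσ : Monotone σ) (d : ℕ → ℝ) (M p : ℕ)
    (hp : p ≠ 0) :
    ∫ t : ℝ, (∑ k ∈ Finset.range M,
      d k * (Set.Ioc (σ k : ℝ) (σ (k + 1))).indicator (fun _ => (1 : ℝ)) t) ^ p
      = ∑ k ∈ Finset.range M, d k ^ p * ((σ (k + 1) : ℝ) - σ k) := by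
  simp only [sum_indicator_Ioc_pow σ hσ d M p hp]
  rw [integral_finsetSum]
  · refine Finset.sum_congr rfl fun k _ => ?_
    have h : (σ k : ℝ) ≤ σ (k + 1) := by exact_mod_cast hσ k.le_succ
    rw [integral_const_mul, integral_indicator_const _ measurableSet_Ioc]
    simp [h]
  · intro k _
    exact ((integrable_indicator_iff measurableSet_Ioc).2
      (integrableOn_const (by simp) )).const_mul _

section

variable {Ω : Type*} [MeasurableSpace Ω] {P : Measure Ω}

/-- Expresses moments through integrals of the step function, free of any ordering of the intervals.
Overlaps must be allowed because differences of sums over two partitions are estimated this way. -/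
lemma HasStepMoments.family {u : ℝ≥0 → Ω → ℝ} {q κ : ℝ} (h : HasStepMoments P u q κ)
    {ι : Type*} [Fintype ι] (A B : ι → ℝ≥0) (hAB : ∀ i, A i ≤ B i) (c : ι → ℝ) :
    MemLp (fun ω => ∑ i, c i * (u (B i) ω - u (A i) ω)) 4 P ∧
    ∫ ω, (∑ i, c i * (u (B i) ω - u (A i) ω)) ^ 2 ∂P = q * ∫ t, intervalStep A B c t ^ 2 ∧
    ∫ ω, (∑ i, c i * (u (B i) ω - u (A i) ω)) ^ 4 ∂P
      = 3 * (q * ∫ t, intervalStep A B c t ^ 2) ^ 2 + κ * ∫ t, intervalStep A B c t ^ 4 := by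
  obtain ⟨σ, d, M, hσ, hd⟩ := exists_common_refinement A B hAB c
  have hu : ∀ ω, ∑ i, c i * (u (B i) ω - u (A i) ω)
      = ∑ k ∈ Finset.range M, d k * (u (σ (k + 1)) ω - u (σ k) ω) := fun ω => hd fun s => u s ω
  have hF : ∀ t, intervalStep A B c t = ∑ k ∈ Finset.range M,
      d k * (Set.Ioc (σ k : ℝ) (σ (k + 1))).indicator (fun _ => (1 : ℝ)) t := by
    intro t
    -- The increment of `s ↦ 1_{t ≤ s}` over `(A, B]` is the indicator of that interval at `t`.
    have := hd fun s => if t ≤ s then 1 else 0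
    simp only [intervalStep, indicator_Ioc_eq_sub (hAB _), indicator_Ioc_eq_sub (hσ (Nat.le_succ _))]
    exact this
  simp only [hu, hF]
  rw [integral_sum_indicator_Ioc_pow σ hσ d M 2 (by norm_num),
    integral_sum_indicator_Ioc_pow σ hσ d M 4 (by norm_num)]
  exact ⟨h.memLp σ d M hσ, h.two σ d M hσ, h.four σ d M hσ⟩

end

/-! ### Step functions on partitions and their pointwise limits. -/

section Partition

variable {T : ℝ≥0}

/-- The step function equal to `c i` on `(pt i, pt (i + 1)]`. -/
noncomputable def TimePartition.stepFn (π : TimePartition T) (c : ℕ → ℝ) (t : ℝ) : ℝ :=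
  ∑ i ∈ Finset.range π.size,
    c i * (Set.Ioc (π.pt i : ℝ) (π.pt (i + 1))).indicator (fun _ => 1) t

namespace TimePartition

lemma exists_mem_Ioc (π : TimePartition T) {t : ℝ} (ht : t ∈ Set.Ioc (0 : ℝ) T) :
    ∃ i < π.size, t ∈ Set.Ioc (π.pt i : ℝ) (π.pt (i + 1)) := by
  classical
  -- The least such `j` is not `0` since `t > 0`; its predecessor indexes the cell containing `t`.
  have hex : ∃ j, t ≤ π.pt j := ⟨π.size, by rw [π.pt_size]; exact ht.2⟩
  have hj := Nat.find_spec hex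
  have hmin := fun m => Nat.find_min hex (m := m)
  have hle : Nat.find hex ≤ π.size := Nat.find_le (by rw [π.pt_size]; exact ht.2)
  generalize Nat.find hex = j at *
  cases j with
  | zero => rw [π.pt_zero] at hj; simp at hj; linarith [ht.1]
  | succ i => exact ⟨i, by omega, by simpa using hmin i (by omega), hj⟩

lemma stepFn_eq (π : TimePartition T) (c : ℕ → ℝ) {t : ℝ} {i : ℕ} (hi : i < π.size)
    (ht : t ∈ Set.Ioc (π.pt i : ℝ) (π.pt (i + 1))) : π.stepFn c t = c i := by
  have hother : ∀ j, j ≠ i → t ∉ Set.Ioc (π.pt j : ℝ) (π.pt (j + 1)) := by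
    intro j hj hjt
    rcases lt_or_gt_of_ne hj with h | h
    · have h1 : (π.pt (j + 1) : ℝ) ≤ π.pt i := by exact_mod_cast π.mono h
      linarith [hjt.2, ht.1]
    · have h1 : (π.pt (i + 1) : ℝ) ≤ π.pt j := by exact_mod_cast π.mono h
      linarith [hjt.1, ht.2]
  rw [stepFn, Finset.sum_eq_single_of_mem i (Finset.mem_range.2 hi), Set.indicator_of_mem ht,
    mul_one]
  intro j _ hj
  rw [Set.indicator_of_notMem (hother j hj), mul_zero]

lemma pt_le (π : TimePartition T) {i : ℕ} (hi : i ≤ π.size) : π.pt i ≤ T :=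
  (π.mono hi).trans π.pt_size.le

lemma stepFn_eq_zero (π : TimePartition T) (c : ℕ → ℝ) {t : ℝ} (ht : t ∉ Set.Ioc (0 : ℝ) T) :
    π.stepFn c t = 0 := by
  refine Finset.sum_eq_zero fun i hi => ?_
  rw [Set.indicator_of_notMem, mul_zero]
  refine fun h => ht ⟨lt_of_le_of_lt (π.pt i).2 h.1, h.2.trans ?_⟩
  exact_mod_cast π.pt_le (Finset.mem_range.1 hi)

lemma sub_le_mesh (π : TimePartition T) {i : ℕ} (hi : i < π.size) :
    (π.pt (i + 1) : ℝ) - π.pt i ≤ π.mesh := by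
  have h : π.pt (i + 1) - π.pt i ≤ π.mesh :=
    Finset.le_sup (f := fun i => π.pt (i + 1) - π.pt i) (Finset.mem_range.2 hi)
  have h' : ((π.pt (i + 1) - π.pt i : ℝ≥0) : ℝ) ≤ π.mesh := by exact_mod_cast h
  rwa [NNReal.coe_sub (π.mono i.le_succ)] at h'

@[fun_prop]
lemma measurable_stepFn (π : TimePartition T) (c : ℕ → ℝ) : Measurable (π.stepFn c) := by
  refine Finset.measurable_fun_sum _ fun i _ => Measurable.const_mul ?_ _
  exact measurable_const.indicator measurableSet_Ioc

lemma abs_stepFn_le (π : TimePartition T) (c : ℕ → ℝ) {C : ℝ} (hC : ∀ i < π.size, |c i| ≤ C)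
    {t : ℝ} (ht : t ∈ Set.Ioc (0 : ℝ) T) : |π.stepFn c t| ≤ C := by
  obtain ⟨i, hi, hit⟩ := π.exists_mem_Ioc ht
  rw [π.stepFn_eq c hi hit]
  exact hC i hi

/-- The partition of `[0, T]` into `k + 1` intervals of equal length. -/
noncomputable def uniform (T : ℝ≥0) (k : ℕ) : TimePartition T where
  size := k + 1
  pt i := T * i / (k + 1)
  mono := fun i j hij => by dsimp only; gcongr
  pt_zero := by simp
  pt_size := by push_cast; field_simp

lemma tendsto_mesh_uniform (T : ℝ≥0) : Tendsto (fun k => (uniform T k).mesh) atTop (𝓝 0) := by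
  have h : ∀ k, (uniform T k).mesh ≤ T * (1 / ((k : ℝ≥0) + 1)) := by
    intro k
    refine Finset.sup_le fun i _ => ?_
    simp only [uniform]
    rw [tsub_le_iff_right]
    refine le_of_eq ?_
    push_cast; field_simp; ring
  have h2 : Tendsto (fun k : ℕ => T * (1 / ((k : ℝ≥0) + 1))) atTop (𝓝 0) := by
    have := (tendsto_one_div_add_atTop_nhds_zero_nat (𝕜 := ℝ≥0)).const_mul T
    simpa using this
  exact tendsto_of_tendsto_of_tendsto_of_le_of_le tendsto_const_nhds h2 (fun _ => zero_le) h

variable {ι : Type*} {l : Filter ι}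

/-- The left endpoint of the cell containing `t` tends to `t` from below, so left continuity is the
matching hypothesis. -/
lemma tendsto_stepFn_left {π : ι → TimePartition T} (hπ : Tendsto (fun k => (π k).mesh) l (𝓝 0))
    {F : ℝ≥0 → ℝ} {t : ℝ} (ht : t ∈ Set.Ioc (0 : ℝ) T)
    (hF : ContinuousWithinAt F (Set.Iic t.toNNReal) t.toNNReal) :
    Tendsto (fun k => (π k).stepFn (fun i => F ((π k).pt i)) t) l (𝓝 (F t.toNNReal)) := by
  choose i hi hit using fun k => (π k).exists_mem_Ioc ht
  have heq : ∀ k, (π k).stepFn (fun i => F ((π k).pt i)) t = F ((π k).pt (i k)) := fun k =>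
    (π k).stepFn_eq _ (hi k) (hit k)
  simp only [heq]
  refine hF.tendsto.comp (tendsto_nhdsWithin_iff.2 ⟨?_, Eventually.of_forall fun k => ?_⟩)
  · rw [tendsto_iff_dist_tendsto_zero]
    have hm : Tendsto (fun k => ((π k).mesh : ℝ)) l (𝓝 0) := by
      have := NNReal.tendsto_coe.2 hπ
      rwa [NNReal.coe_zero] at this
    refine squeeze_zero (fun _ => dist_nonneg) (fun k => ?_) hm
    rw [NNReal.dist_eq, Real.coe_toNNReal _ ht.1.le, abs_sub_comm,
      abs_of_nonneg (by linarith [(hit k).1])]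
    linarith [(hit k).2, (π k).sub_le_mesh (hi k)]
  · exact NNReal.le_toNNReal_of_coe_le (hit k).1.le

/-- The counterpart for right-continuous functions, applied to paths of the noise after summation by
parts. -/
lemma tendsto_stepFn_right {π : ι → TimePartition T} (hπ : Tendsto (fun k => (π k).mesh) l (𝓝 0))
    {F : ℝ≥0 → ℝ} {t : ℝ} (ht : t ∈ Set.Ioc (0 : ℝ) T)
    (hF : ContinuousWithinAt F (Set.Ici t.toNNReal) t.toNNReal) :
    Tendsto (fun k => (π k).stepFn (fun i => F ((π k).pt (i + 1))) t) l (𝓝 (F t.toNNReal)) := by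
  choose i hi hit using fun k => (π k).exists_mem_Ioc ht
  have heq : ∀ k, (π k).stepFn (fun i => F ((π k).pt (i + 1))) t = F ((π k).pt (i k + 1)) :=
    fun k => (π k).stepFn_eq _ (hi k) (hit k)
  simp only [heq]
  refine hF.tendsto.comp (tendsto_nhdsWithin_iff.2 ⟨?_, Eventually.of_forall fun k => ?_⟩)
  · rw [tendsto_iff_dist_tendsto_zero]
    have hm : Tendsto (fun k => ((π k).mesh : ℝ)) l (𝓝 0) := by
      have := NNReal.tendsto_coe.2 hπ
      rwa [NNReal.coe_zero] at this
    refine squeeze_zero (fun _ => dist_nonneg) (fun k => ?_) hm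
    rw [NNReal.dist_eq, Real.coe_toNNReal _ ht.1.le, abs_of_nonneg (by linarith [(hit k).2])]
    linarith [(hit k).1, (π k).sub_le_mesh (hi k)]
  · exact Real.toNNReal_le_iff_le_coe.2 (hit k).2

end TimePartition

end Partition

/-! ### Even moments and convergence in `L^k`. -/

section

variable {Ω : Type*} [MeasurableSpace Ω] {P : Measure Ω}

lemma MeasureTheory.MemLp.integral_even_pow {X : Ω → ℝ} {k : ℕ} (hk : k ≠ 0) (hke : Even k)
    (hX : MemLp X k P) : ∫ ω, X ω ^ k ∂P = (eLpNorm X k P).toReal ^ k := by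
  have hk' : (k : ℝ) ≠ 0 := by exact_mod_cast hk
  have h0 : 0 ≤ ∫ ω, X ω ^ k ∂P := integral_nonneg fun ω => hke.pow_nonneg _
  rw [hX.eLpNorm_eq_integral_rpow_norm (by exact_mod_cast hk) (by simp)]
  have : ∀ ω, ‖X ω‖ ^ (k : ℝ) = X ω ^ k := fun ω => by
    rw [Real.rpow_natCast, Real.norm_eq_abs, hke.pow_abs]
  simp only [ENNReal.toReal_natCast, this]
  rw [ENNReal.toReal_ofReal (by positivity), ← Real.rpow_natCast, ← Real.rpow_mul h0,
    inv_mul_cancel₀ hk', Real.rpow_one]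

lemma tendsto_eLpNorm_of_tendsto_integral_pow {ι : Type*} {l : Filter ι} {X : ι → Ω → ℝ} {k : ℕ}
    (hk : k ≠ 0) (hke : Even k) (hX : ∀ i, MemLp (X i) k P)
    (h : Tendsto (fun i => ∫ ω, X i ω ^ k ∂P) l (𝓝 0)) :
    Tendsto (fun i => eLpNorm (X i) k P) l (𝓝 0) := by
  rw [← ENNReal.tendsto_toReal_iff (fun i => (hX i).2.ne) (by simp), ENNReal.toReal_zero]
  simp only [fun i => (hX i).integral_even_pow hk hke] at h
  have h2 := h.rpow_const (p := (k : ℝ)⁻¹) (Or.inr (by positivity))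
  rw [Real.zero_rpow (by positivity)] at h2
  refine h2.congr fun i => ?_
  rw [Real.pow_rpow_inv_natCast ENNReal.toReal_nonneg hk]

lemma tendsto_integral_pow_of_tendsto_eLpNorm {ι : Type*} {l : Filter ι} {X : ι → Ω → ℝ}
    {J : Ω → ℝ} {k : ℕ} (hk : k ≠ 0) (hke : Even k) (hX : ∀ i, MemLp (X i) k P) (hJ : MemLp J k P)
    (h : Tendsto (fun i => eLpNorm (X i - J) k P) l (𝓝 0)) :
    Tendsto (fun i => ∫ ω, X i ω ^ k ∂P) l (𝓝 (∫ ω, J ω ^ k ∂P)) := by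
  have hk1 : (1 : ℝ≥0∞) ≤ k := by exact_mod_cast Nat.one_le_iff_ne_zero.2 hk
  have : Fact ((1 : ℝ≥0∞) ≤ k) := ⟨hk1⟩
  have hL : Tendsto (fun i => (hX i).toLp (X i)) l (𝓝 (hJ.toLp J)) := by
    rw [Lp.tendsto_Lp_iff_tendsto_eLpNorm'' X hX J hJ]
    exact h
  have hn := (hL.norm).pow k
  simp only [Lp.norm_toLp] at hn
  rw [hJ.integral_even_pow hk hke]
  refine hn.congr fun i => ?_
  rw [(hX i).integral_even_pow hk hke]

end

/-! ### The integral against `u` as a limit in `L⁴`, and its mixed moments. -/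

section Partition

variable {T : ℝ≥0} {Ω : Type*} [MeasurableSpace Ω] {P : Measure Ω} {u : ℝ≥0 → Ω → ℝ} {q κ : ℝ}

/-- The step function `∑ F(t_i) 1_{(t_i, t_{i+1}]}`. -/
noncomputable abbrev TimePartition.leftStep (π : TimePartition T) (F : ℝ≥0 → ℝ) (t : ℝ) : ℝ :=
  π.stepFn (fun i => F (π.pt i)) t

lemma integral_Ioc_of_eq_zero {φ : ℝ → ℝ} (h : ∀ t ∉ Set.Ioc (0 : ℝ) T, φ t = 0) :
    ∫ t, φ t = ∫ t in Set.Ioc (0 : ℝ) T, φ t :=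
  (setIntegral_eq_integral_of_forall_compl_eq_zero h).symm

lemma HasStepMoments.elemIntegral_moments (h : HasStepMoments P u q κ) (π : TimePartition T)
    (F : ℝ≥0 → ℝ) :
    MemLp (elemIntegral u F π) 4 P ∧
    ∫ ω, elemIntegral u F π ω ^ 2 ∂P = q * ∫ t in Set.Ioc (0 : ℝ) T, π.leftStep F t ^ 2 ∧
    ∫ ω, elemIntegral u F π ω ^ 4 ∂P
      = 3 * (q * ∫ t in Set.Ioc (0 : ℝ) T, π.leftStep F t ^ 2) ^ 2
        + κ * ∫ t in Set.Ioc (0 : ℝ) T, π.leftStep F t ^ 4 := by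
  have hfam := h.family (ι := Fin π.size) (fun i => π.pt i) (fun i => π.pt (i + 1))
    (fun i => π.mono (Nat.le_succ _)) (fun i => F (π.pt i))
  have e1 : ∀ ω, ∑ i : Fin π.size, F (π.pt i) * (u (π.pt (i + 1)) ω - u (π.pt i) ω)
      = elemIntegral u F π ω := fun ω =>
    (Finset.sum_range fun i => F (π.pt i) * (u (π.pt (i + 1)) ω - u (π.pt i) ω)).symm
  have e2 : ∀ t, intervalStep (fun i : Fin π.size => π.pt i) (fun i => π.pt (i + 1))
      (fun i => F (π.pt i)) t = π.leftStep F t := fun t =>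
    (Finset.sum_range fun i => F (π.pt i) *
      (Set.Ioc (π.pt i : ℝ) (π.pt (i + 1))).indicator (fun _ => 1) t).symm
  simp only [e1, e2] at hfam
  have h0 : ∀ p : ℕ, p ≠ 0 → ∀ t ∉ Set.Ioc (0 : ℝ) T, π.leftStep F t ^ p = 0 := fun p hp t ht => by
    rw [TimePartition.leftStep, π.stepFn_eq_zero _ ht, zero_pow hp]
  rwa [integral_Ioc_of_eq_zero (h0 2 (by norm_num)),
    integral_Ioc_of_eq_zero (h0 4 (by norm_num))] at hfam

/-- The two sums form one family indexed by the disjoint union of the cells, with the coefficients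
of the second negated. -/
lemma HasStepMoments.elemIntegral_sub (h : HasStepMoments P u q κ) (π π' : TimePartition T)
    (F : ℝ≥0 → ℝ) :
    ∫ ω, (elemIntegral u F π ω - elemIntegral u F π' ω) ^ 4 ∂P
      = 3 * (q * ∫ t in Set.Ioc (0 : ℝ) T, (π.leftStep F t - π'.leftStep F t) ^ 2) ^ 2
        + κ * ∫ t in Set.Ioc (0 : ℝ) T, (π.leftStep F t - π'.leftStep F t) ^ 4 := by
  have hfam := h.family (ι := Fin π.size ⊕ Fin π'.size)
    (Sum.elim (fun i => π.pt i) (fun i => π'.pt i))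
    (Sum.elim (fun i => π.pt (i + 1)) (fun i => π'.pt (i + 1)))
    (by rintro (i | i); exacts [π.mono (Nat.le_succ _), π'.mono (Nat.le_succ _)])
    (Sum.elim (fun i => F (π.pt i)) (fun i => - F (π'.pt i)))
  simp only [intervalStep, Fintype.sum_sum_type, Sum.elim_inl, Sum.elim_inr, neg_mul,
    Finset.sum_neg_distrib, ← sub_eq_add_neg] at hfam
  have e1 : ∀ (ρ : TimePartition T) (ω : Ω),
      ∑ i : Fin ρ.size, F (ρ.pt i) * (u (ρ.pt (i + 1)) ω - u (ρ.pt i) ω)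
      = elemIntegral u F ρ ω := fun ρ ω =>
    (Finset.sum_range fun i => F (ρ.pt i) * (u (ρ.pt (i + 1)) ω - u (ρ.pt i) ω)).symm
  have e2 : ∀ (ρ : TimePartition T) (t : ℝ), ∑ i : Fin ρ.size, F (ρ.pt i) *
      (Set.Ioc (ρ.pt i : ℝ) (ρ.pt (i + 1))).indicator (fun _ => 1) t = ρ.leftStep F t := fun ρ t =>
    (Finset.sum_range fun i => F (ρ.pt i) *
      (Set.Ioc (ρ.pt i : ℝ) (ρ.pt (i + 1))).indicator (fun _ => 1) t).symm
  simp only [e1, e2] at hfam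
  have h0 : ∀ p : ℕ, p ≠ 0 → ∀ t ∉ Set.Ioc (0 : ℝ) T,
      (π.leftStep F t - π'.leftStep F t) ^ p = 0 := fun p hp t ht => by
    rw [TimePartition.leftStep, TimePartition.leftStep, π.stepFn_eq_zero _ ht,
      π'.stepFn_eq_zero _ ht, sub_zero, zero_pow hp]
  rw [integral_Ioc_of_eq_zero (h0 2 (by norm_num)),
    integral_Ioc_of_eq_zero (h0 4 (by norm_num))] at hfam
  exact hfam.2.2

/-- Boundedness and left-continuity on `[0, T]`. -/
structure IsAdmissible (T : ℝ≥0) (F : ℝ≥0 → ℝ) : Prop where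
  bdd : ∃ C : ℝ, ∀ t ≤ T, |F t| ≤ C
  leftCont : ∀ t ≤ T, ContinuousWithinAt F (Set.Iic t) t

lemma toNNReal_le_of_mem_Ioc {t : ℝ} (ht : t ∈ Set.Ioc (0 : ℝ) T) : t.toNNReal ≤ T :=
  Real.toNNReal_le_iff_le_coe.2 ht.2

lemma IsAdmissible.add {F G : ℝ≥0 → ℝ} (hF : IsAdmissible T F) (hG : IsAdmissible T G) :
    IsAdmissible T (fun t => F t + G t) := by
  obtain ⟨C, hC⟩ := hF.bdd
  obtain ⟨D, hD⟩ := hG.bdd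
  exact ⟨⟨C + D, fun t ht => (abs_add_le _ _).trans (add_le_add (hC t ht) (hD t ht))⟩,
    fun t ht => (hF.leftCont t ht).add (hG.leftCont t ht)⟩

lemma IsAdmissible.sub {F G : ℝ≥0 → ℝ} (hF : IsAdmissible T F) (hG : IsAdmissible T G) :
    IsAdmissible T (fun t => F t - G t) := by
  obtain ⟨C, hC⟩ := hF.bdd
  obtain ⟨D, hD⟩ := hG.bdd
  exact ⟨⟨C + D, fun t ht => (abs_sub _ _).trans (add_le_add (hC t ht) (hD t ht))⟩,
    fun t ht => (hF.leftCont t ht).sub (hG.leftCont t ht)⟩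

lemma IsAdmissible.tendsto_leftStep {F : ℝ≥0 → ℝ} (hF : IsAdmissible T F) {ι : Type*}
    {l : Filter ι} {π : ι → TimePartition T} (hπ : Tendsto (fun k => (π k).mesh) l (𝓝 0))
    {t : ℝ} (ht : t ∈ Set.Ioc (0 : ℝ) T) :
    Tendsto (fun k => (π k).leftStep F t) l (𝓝 (F t.toNNReal)) :=
  TimePartition.tendsto_stepFn_left hπ ht (hF.leftCont _ (toNNReal_le_of_mem_Ioc ht))

lemma IsAdmissible.aemeasurable {F : ℝ≥0 → ℝ} (hF : IsAdmissible T F) :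
    AEMeasurable (fun t : ℝ => F t.toNNReal) (volume.restrict (Set.Ioc (0 : ℝ) T)) := by
  refine aemeasurable_of_tendsto_metrizable_ae atTop
    (f := fun k => (TimePartition.uniform T k).leftStep F)
    (fun k => (TimePartition.measurable_stepFn _ _).aemeasurable) ?_
  filter_upwards [ae_restrict_mem measurableSet_Ioc] with t ht
  exact hF.tendsto_leftStep (TimePartition.tendsto_mesh_uniform T) ht

lemma IsAdmissible.abs_leftStep_le {F : ℝ≥0 → ℝ} {C : ℝ} (hC : ∀ t ≤ T, |F t| ≤ C)
    (π : TimePartition T) {t : ℝ} (ht : t ∈ Set.Ioc (0 : ℝ) T) : |π.leftStep F t| ≤ C :=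
  π.abs_stepFn_le _ (fun _ hi => hC _ (π.pt_le hi.le)) ht

lemma IsAdmissible.tendsto_integral_leftStep_pow {F : ℝ≥0 → ℝ} (hF : IsAdmissible T F) {ι : Type*}
    {l : Filter ι} [l.IsCountablyGenerated] {π : ι → TimePartition T}
    (hπ : Tendsto (fun k => (π k).mesh) l (𝓝 0)) (p : ℕ) :
    Tendsto (fun k => ∫ t in Set.Ioc (0 : ℝ) T, (π k).leftStep F t ^ p) l
      (𝓝 (∫ t in Set.Ioc (0 : ℝ) T, F t.toNNReal ^ p)) := by
  obtain ⟨C, hC⟩ := hF.bdd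
  refine tendsto_integral_filter_of_dominated_convergence (fun _ => C ^ p)
    (Eventually.of_forall fun k =>
      ((TimePartition.measurable_stepFn _ _).pow_const p).aestronglyMeasurable)
    (Eventually.of_forall fun k => ?_) (integrable_const _) ?_
  · filter_upwards [ae_restrict_mem measurableSet_Ioc] with t ht
    rw [norm_pow]
    exact pow_le_pow_left₀ (norm_nonneg _) (IsAdmissible.abs_leftStep_le hC _ ht) p
  · filter_upwards [ae_restrict_mem measurableSet_Ioc] with t ht
    exact (hF.tendsto_leftStep hπ ht).pow p

lemma IsAdmissible.tendsto_integral_leftStep_sub_pow {F : ℝ≥0 → ℝ} (hF : IsAdmissible T F)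
    {ι : Type*} {l : Filter ι} [l.IsCountablyGenerated] {π π' : ι → TimePartition T}
    (hπ : Tendsto (fun k => (π k).mesh) l (𝓝 0)) (hπ' : Tendsto (fun k => (π' k).mesh) l (𝓝 0))
    {p : ℕ} (hp : p ≠ 0) :
    Tendsto (fun k => ∫ t in Set.Ioc (0 : ℝ) T, ((π k).leftStep F t - (π' k).leftStep F t) ^ p) l
      (𝓝 0) := by
  obtain ⟨C, hC⟩ := hF.bdd
  have h := tendsto_integral_filter_of_dominated_convergence
    (μ := volume.restrict (Set.Ioc (0 : ℝ) T)) (l := l)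
    (F := fun k t => ((π k).leftStep F t - (π' k).leftStep F t) ^ p) (f := fun _ => 0)
    (fun _ => (C + C) ^ p)
    (Eventually.of_forall fun k => (((TimePartition.measurable_stepFn _ _).sub
      (TimePartition.measurable_stepFn _ _)).pow_const p).aestronglyMeasurable)
    (Eventually.of_forall fun k => ?_) (integrable_const _) ?_
  · simpa using h
  · filter_upwards [ae_restrict_mem measurableSet_Ioc] with t ht
    rw [norm_pow]
    refine pow_le_pow_left₀ (norm_nonneg _) ?_ p
    exact (norm_sub_le _ _).trans (add_le_add (IsAdmissible.abs_leftStep_le hC _ ht)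
      (IsAdmissible.abs_leftStep_le hC _ ht))
  · filter_upwards [ae_restrict_mem measurableSet_Ioc] with t ht
    have := ((hF.tendsto_leftStep hπ ht).sub (hF.tendsto_leftStep hπ' ht)).pow p
    simpa [hp] using this

/-- Both step functions tend boundedly to the same limit, so the exact fourth moment of the
difference tends to `0`. The filter is left general so that `ℕ × ℕ` can be used for the Cauchy
property. -/
lemma HasStepMoments.tendsto_eLpNorm_sub (h : HasStepMoments P u q κ) {F : ℝ≥0 → ℝ}
    (hF : IsAdmissible T F) {ι : Type*} {l : Filter ι} [l.IsCountablyGenerated]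
    {π π' : ι → TimePartition T} (hπ : Tendsto (fun k => (π k).mesh) l (𝓝 0))
    (hπ' : Tendsto (fun k => (π' k).mesh) l (𝓝 0)) :
    Tendsto (fun k => eLpNorm (elemIntegral u F (π k) - elemIntegral u F (π' k)) 4 P)
      l (𝓝 0) := by
  refine tendsto_eLpNorm_of_tendsto_integral_pow (k := 4) (by norm_num) (by decide)
    (fun k => ((h.elemIntegral_moments (π k) F).1.sub (h.elemIntegral_moments (π' k) F).1)) ?_
  simp only [Pi.sub_apply, h.elemIntegral_sub]
  have h2 := hF.tendsto_integral_leftStep_sub_pow hπ hπ' (p := 2) (by norm_num)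
  have h4 := hF.tendsto_integral_leftStep_sub_pow hπ hπ' (p := 4) (by norm_num)
  have := (((h2.const_mul q).pow 2).const_mul 3).add (h4.const_mul κ)
  simpa using this

/-- `J` is the limit in `L⁴` of the elementary integrals of `F` against `u`. -/
structure IsL4Integral (P : Measure Ω) (u : ℝ≥0 → Ω → ℝ) (F : ℝ≥0 → ℝ) (T : ℝ≥0) (J : Ω → ℝ) :
    Prop where
  memLp : MemLp J 4 P
  tendsto : ∀ π : ℕ → TimePartition T, Tendsto (fun k => (π k).mesh) atTop (𝓝 0) →
    Tendsto (fun k => eLpNorm (elemIntegral u F (π k) - J) 4 P) atTop (𝓝 0)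

/-- Uniform partitions give a Cauchy sequence in the complete space `L⁴`; every other partition
sequence is compared with them. -/
lemma HasStepMoments.exists_isL4Integral (h : HasStepMoments P u q κ) {F : ℝ≥0 → ℝ}
    (hF : IsAdmissible T F) : ∃ J, IsL4Integral P u F T J := by
  have : Fact ((1 : ℝ≥0∞) ≤ 4) := ⟨by norm_num⟩
  set S : ℕ → Ω → ℝ := fun k => elemIntegral u F (TimePartition.uniform T k) with hS
  have hSm : ∀ k, MemLp (S k) 4 P := fun k => (h.elemIntegral_moments _ F).1
  have hc : CauchySeq (fun k => (hSm k).toLp (S k)) := by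
    rw [cauchySeq_iff_tendsto_dist_atTop_0]
    have hf : Tendsto (fun n : ℕ × ℕ => n.1) atTop atTop := by
      rw [← prod_atTop_atTop_eq]; exact tendsto_fst
    have hs : Tendsto (fun n : ℕ × ℕ => n.2) atTop atTop := by
      rw [← prod_atTop_atTop_eq]; exact tendsto_snd
    have hlim := h.tendsto_eLpNorm_sub hF (l := (atTop : Filter (ℕ × ℕ)))
      ((TimePartition.tendsto_mesh_uniform T).comp hf)
      ((TimePartition.tendsto_mesh_uniform T).comp hs)
    have := (ENNReal.tendsto_toReal (by simp)).comp hlim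
    rw [ENNReal.toReal_zero] at this
    refine this.congr fun n => ?_
    rw [dist_eq_norm, ← MemLp.toLp_sub, Lp.norm_toLp]
    rfl
  obtain ⟨L, hL⟩ := cauchySeq_tendsto_of_complete hc
  obtain ⟨J, hJm, hJ⟩ : ∃ J : Ω → ℝ, MemLp J 4 P ∧
      Tendsto (fun k => eLpNorm (S k - J) 4 P) atTop (𝓝 0) := by
    refine ⟨L, Lp.memLp L, ?_⟩
    rw [← Lp.toLp_coeFn L (Lp.memLp L)] at hL
    exact (Lp.tendsto_Lp_iff_tendsto_eLpNorm'' S hSm L (Lp.memLp L)).1 hL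
  refine ⟨J, hJm, fun π hπ => ?_⟩
  have h2 := h.tendsto_eLpNorm_sub hF hπ (TimePartition.tendsto_mesh_uniform T)
  have h3 := h2.add hJ
  rw [add_zero] at h3
  refine tendsto_of_tendsto_of_tendsto_of_le_of_le tendsto_const_nhds h3 (fun _ => zero_le)
    fun k => ?_
  have : elemIntegral u F (π k) - J
      = (elemIntegral u F (π k) - S k) + (S k - J) := by abel
  dsimp only
  rw [this]
  exact eLpNorm_add_le ((h.elemIntegral_moments (π k) F).1.sub (hSm k)).1 ((hSm k).sub hJm).1 (by norm_num)

lemma IsL4Integral.isStochIntegral {F : ℝ≥0 → ℝ} {J : Ω → ℝ} (h : HasStepMoments P u q κ)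
    (hJ : IsL4Integral P u F T J) : IsStochIntegral P u F T J :=
  ⟨hJ.memLp.1.aemeasurable, fun π hπ => tendstoInMeasure_of_tendsto_eLpNorm (p := 4) (by norm_num)
    (fun k => (h.elemIntegral_moments (π k) F).1.1) hJ.memLp.1 (hJ.tendsto π hπ)⟩

lemma IsL4Integral.moments [IsProbabilityMeasure P] {F : ℝ≥0 → ℝ} {J : Ω → ℝ}
    (h : HasStepMoments P u q κ) (hF : IsAdmissible T F) (hJ : IsL4Integral P u F T J) :
    ∫ ω, J ω ^ 2 ∂P = q * ∫ t in Set.Ioc (0 : ℝ) T, F t.toNNReal ^ 2 ∧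
    ∫ ω, J ω ^ 4 ∂P = 3 * (q * ∫ t in Set.Ioc (0 : ℝ) T, F t.toNNReal ^ 2) ^ 2
      + κ * ∫ t in Set.Ioc (0 : ℝ) T, F t.toNNReal ^ 4 := by
  have hm := TimePartition.tendsto_mesh_uniform T
  have hlim := hJ.tendsto _ hm
  have hmem := fun k => (h.elemIntegral_moments (TimePartition.uniform T k) F).1
  have le24 : ((2 : ℕ) : ℝ≥0∞) ≤ 4 := by norm_num
  have h4 := tendsto_integral_pow_of_tendsto_eLpNorm (k := 4) (by norm_num) (by decide) hmem
    hJ.memLp hlim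
  have h2 := tendsto_integral_pow_of_tendsto_eLpNorm (k := 2) (by norm_num) (by decide)
    (fun k => (hmem k).mono_exponent le24) (hJ.memLp.mono_exponent le24)
    (tendsto_of_tendsto_of_tendsto_of_le_of_le tendsto_const_nhds hlim (fun _ => zero_le)
      fun k => eLpNorm_le_eLpNorm_of_exponent_le le24 ((hmem k).sub hJ.memLp).1)
  have f2 := hF.tendsto_integral_leftStep_pow hm 2
  have f4 := hF.tendsto_integral_leftStep_pow hm 4
  simp only [(h.elemIntegral_moments (TimePartition.uniform T _) F).2.1] at h2
  simp only [(h.elemIntegral_moments (TimePartition.uniform T _) F).2.2] at h4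
  exact ⟨tendsto_nhds_unique h2 (f2.const_mul q),
    tendsto_nhds_unique h4 ((((f2.const_mul q).pow 2).const_mul 3).add (f4.const_mul κ))⟩

lemma IsL4Integral.add {F G : ℝ≥0 → ℝ} {J K : Ω → ℝ} (h : HasStepMoments P u q κ)
    (hJ : IsL4Integral P u F T J) (hK : IsL4Integral P u G T K) :
    IsL4Integral P u (fun t => F t + G t) T (J + K) := by
  refine ⟨hJ.memLp.add hK.memLp, fun π hπ => ?_⟩
  have h3 := (hJ.tendsto π hπ).add (hK.tendsto π hπ)
  rw [add_zero] at h3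
  refine tendsto_of_tendsto_of_tendsto_of_le_of_le tendsto_const_nhds h3 (fun _ => zero_le)
    fun k => ?_
  have : elemIntegral u (fun t => F t + G t) (π k) - (J + K)
      = (elemIntegral u F (π k) - J) + (elemIntegral u G (π k) - K) := by
    ext ω
    simp only [elemIntegral, Pi.sub_apply, Pi.add_apply, add_mul, Finset.sum_add_distrib]
    ring
  dsimp only
  rw [this]
  exact eLpNorm_add_le ((h.elemIntegral_moments (π k) F).1.sub hJ.memLp).1
    ((h.elemIntegral_moments (π k) G).1.sub hK.memLp).1 (by norm_num)

lemma IsL4Integral.sub {F G : ℝ≥0 → ℝ} {J K : Ω → ℝ} (h : HasStepMoments P u q κ)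
    (hJ : IsL4Integral P u F T J) (hK : IsL4Integral P u G T K) :
    IsL4Integral P u (fun t => F t - G t) T (J - K) := by
  refine ⟨hJ.memLp.sub hK.memLp, fun π hπ => ?_⟩
  have h3 := (hJ.tendsto π hπ).add (hK.tendsto π hπ)
  rw [add_zero] at h3
  refine tendsto_of_tendsto_of_tendsto_of_le_of_le tendsto_const_nhds h3 (fun _ => zero_le)
    fun k => ?_
  have : elemIntegral u (fun t => F t - G t) (π k) - (J - K)
      = (elemIntegral u F (π k) - J) - (elemIntegral u G (π k) - K) := by
    ext ω
    simp only [elemIntegral, Pi.sub_apply, sub_mul, Finset.sum_sub_distrib]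
    ring
  dsimp only
  rw [this]
  exact eLpNorm_sub_le ((h.elemIntegral_moments (π k) F).1.sub hJ.memLp).1
    ((h.elemIntegral_moments (π k) G).1.sub hK.memLp).1 (by norm_num)

lemma IsAdmissible.integrable_mul_pow {F G : ℝ≥0 → ℝ} (hF : IsAdmissible T F)
    (hG : IsAdmissible T G) (j k : ℕ) :
    IntegrableOn (fun t : ℝ => F t.toNNReal ^ j * G t.toNNReal ^ k) (Set.Ioc (0 : ℝ) T) := by
  obtain ⟨C, hC⟩ := hF.bdd
  obtain ⟨D, hD⟩ := hG.bdd
  refine Integrable.of_bound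
    ((hF.aemeasurable.pow_const j).mul (hG.aemeasurable.pow_const k)).aestronglyMeasurable
    (C ^ j * D ^ k) ?_
  filter_upwards [ae_restrict_mem measurableSet_Ioc] with t ht
  have ht' := toNNReal_le_of_mem_Ioc ht
  rw [norm_mul, norm_pow, norm_pow]
  have h1 := pow_le_pow_left₀ (abs_nonneg _) (hC _ ht') j
  have h2 := pow_le_pow_left₀ (abs_nonneg _) (hD _ ht') k
  exact mul_le_mul h1 h2 (by positivity) ((by positivity : (0 : ℝ) ≤ |F t.toNNReal| ^ j).trans h1)

lemma MeasureTheory.MemLp.integrable_sq_mul_sq [IsProbabilityMeasure P] {J K : Ω → ℝ}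
    (hJ : MemLp J 4 P) (hK : MemLp K 4 P) :
    Integrable (fun ω => J ω ^ 2 * K ω ^ 2) P := by
  have h : ∀ ω, J ω ^ 2 * K ω ^ 2
      = ((J ω + K ω) ^ 4 + (J ω - K ω) ^ 4 - 2 * J ω ^ 4 - 2 * K ω ^ 4) / 12 := fun ω => by ring
  simp only [h]
  exact (((((hJ.add hK).integrable_pow_le le_rfl).add ((hJ.sub hK).integrable_pow_le le_rfl)).sub
    ((hJ.integrable_pow_le le_rfl).const_mul 2)).sub
    ((hK.integrable_pow_le le_rfl).const_mul 2)).div_const 12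

/-- Polarisation: `J² K²` is a combination of the fourth powers of `J ± K`, `J` and `K`, and `J ± K`
are the integrals of `F ± G`. The quartic form `3 (q ∫ F²)² + κ ∫ F⁴` then polarises to the
right-hand side. -/
lemma IsL4Integral.integral_sq_mul_sq [IsProbabilityMeasure P] {F G : ℝ≥0 → ℝ} {J K : Ω → ℝ}
    (h : HasStepMoments P u q κ) (hF : IsAdmissible T F) (hG : IsAdmissible T G)
    (hJ : IsL4Integral P u F T J) (hK : IsL4Integral P u G T K) :
    ∫ ω, J ω ^ 2 * K ω ^ 2 ∂P = (∫ ω, J ω ^ 2 ∂P) * (∫ ω, K ω ^ 2 ∂P)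
      + 2 * (q * ∫ t in Set.Ioc (0 : ℝ) T, F t.toNNReal * G t.toNNReal) ^ 2
      + κ * ∫ t in Set.Ioc (0 : ℝ) T, F t.toNNReal ^ 2 * G t.toNNReal ^ 2 := by
  have hsplit : ∀ ω, J ω ^ 2 * K ω ^ 2
      = ((J ω + K ω) ^ 4 + (J ω - K ω) ^ 4 - 2 * J ω ^ 4 - 2 * K ω ^ 4) / 12 := fun ω => by ring
  have ia := (hJ.memLp.add hK.memLp).integrable_pow_le (k := 4) le_rfl
  have is := (hJ.memLp.sub hK.memLp).integrable_pow_le (k := 4) le_rfl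
  have ij := (hJ.memLp.integrable_pow_le (k := 4) le_rfl).const_mul 2
  have ik := (hK.memLp.integrable_pow_le (k := 4) le_rfl).const_mul 2
  have mJ := hJ.moments h hF
  have mK := hK.moments h hG
  have mA := (hJ.add h hK).moments h (hF.add hG)
  have mS := (hJ.sub h hK).moments h (hF.sub hG)
  have hJK : ∫ ω, J ω ^ 2 * K ω ^ 2 ∂P = (∫ ω, (J + K) ω ^ 4 ∂P + ∫ ω, (J - K) ω ^ 4 ∂P
      - 2 * ∫ ω, J ω ^ 4 ∂P - 2 * ∫ ω, K ω ^ 4 ∂P) / 12 := by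
    simp only [hsplit]
    rw [integral_div, integral_sub, integral_sub, integral_add, integral_const_mul,
      integral_const_mul]
    · rfl
    · exact ia
    · exact is
    · exact ia.add is
    · exact ij
    · exact (ia.add is).sub ij
    · exact ik
  have i := hF.integrable_mul_pow hG
  have i20 : IntegrableOn (fun t : ℝ => F t.toNNReal ^ 2) (Set.Ioc (0 : ℝ) T) := by
    simpa using i 2 0
  have i02 : IntegrableOn (fun t : ℝ => G t.toNNReal ^ 2) (Set.Ioc (0 : ℝ) T) := by
    simpa using i 0 2
  have i11 : IntegrableOn (fun t : ℝ => F t.toNNReal * G t.toNNReal) (Set.Ioc (0 : ℝ) T) := by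
    simpa using i 1 1
  have i40 : IntegrableOn (fun t : ℝ => F t.toNNReal ^ 4) (Set.Ioc (0 : ℝ) T) := by
    simpa using i 4 0
  have i04 : IntegrableOn (fun t : ℝ => G t.toNNReal ^ 4) (Set.Ioc (0 : ℝ) T) := by
    simpa using i 0 4
  have i22 := i 2 2
  have i31 : IntegrableOn (fun t : ℝ => F t.toNNReal ^ 3 * G t.toNNReal) (Set.Ioc (0 : ℝ) T) := by
    simpa using i 3 1
  have i13 : IntegrableOn (fun t : ℝ => F t.toNNReal * G t.toNNReal ^ 3) (Set.Ioc (0 : ℝ) T) := by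
    simpa using i 1 3
  -- The parameter `e` takes the values `1` and `-1`, covering the sum and the difference together.
  have sq : ∀ e : ℝ, ∫ t in Set.Ioc (0 : ℝ) T, (F t.toNNReal + e * G t.toNNReal) ^ 2
      = (∫ t in Set.Ioc (0 : ℝ) T, F t.toNNReal ^ 2)
        + (2 * e) * (∫ t in Set.Ioc (0 : ℝ) T, F t.toNNReal * G t.toNNReal)
        + e ^ 2 * (∫ t in Set.Ioc (0 : ℝ) T, G t.toNNReal ^ 2) := by
    intro e
    have : ∀ x y : ℝ, (x + e * y) ^ 2 = x ^ 2 + (2 * e) * (x * y) + e ^ 2 * y ^ 2 := fun x y => by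
      ring
    simp only [this]
    rw [integral_add, integral_add, integral_const_mul, integral_const_mul]
    · exact i20
    · exact i11.const_mul _
    · exact i20.add (i11.const_mul _)
    · exact i02.const_mul _
  have qu : ∀ e : ℝ, ∫ t in Set.Ioc (0 : ℝ) T, (F t.toNNReal + e * G t.toNNReal) ^ 4
      = (∫ t in Set.Ioc (0 : ℝ) T, F t.toNNReal ^ 4)
        + (4 * e) * (∫ t in Set.Ioc (0 : ℝ) T, F t.toNNReal ^ 3 * G t.toNNReal)
        + (6 * e ^ 2) * (∫ t in Set.Ioc (0 : ℝ) T, F t.toNNReal ^ 2 * G t.toNNReal ^ 2)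
        + (4 * e ^ 3) * (∫ t in Set.Ioc (0 : ℝ) T, F t.toNNReal * G t.toNNReal ^ 3)
        + e ^ 4 * (∫ t in Set.Ioc (0 : ℝ) T, G t.toNNReal ^ 4) := by
    intro e
    have : ∀ x y : ℝ, (x + e * y) ^ 4 = x ^ 4 + (4 * e) * (x ^ 3 * y)
        + (6 * e ^ 2) * (x ^ 2 * y ^ 2) + (4 * e ^ 3) * (x * y ^ 3) + e ^ 4 * y ^ 4 := fun x y => by
      ring
    simp only [this]
    rw [integral_add, integral_add, integral_add, integral_add, integral_const_mul,
      integral_const_mul, integral_const_mul, integral_const_mul]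
    · exact i40
    · exact i31.const_mul _
    · exact i40.add (i31.const_mul _)
    · exact i22.const_mul _
    · exact (i40.add (i31.const_mul _)).add (i22.const_mul _)
    · exact i13.const_mul _
    · exact ((i40.add (i31.const_mul _)).add (i22.const_mul _)).add (i13.const_mul _)
    · exact i04.const_mul _
  have s1 := sq 1
  have s2 := sq (-1)
  have q1 := qu 1
  have q2 := qu (-1)
  simp only [one_mul, neg_mul, ← sub_eq_add_neg] at s1 s2 q1 q2
  rw [hJK, mJ.1, mK.1, mJ.2, mK.2, mA.2, mS.2, s1, s2, q1, q2]
  ring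

end Partition

/-! ### The Volterra transform and the passage from `ξ` to `u`. -/

lemma integral_mul_integral_tail_eq {p q : ℝ → ℝ} {α β : ℝ} (hαβ : α ≤ β)
    (hp : IntervalIntegrable p volume α β) (hq : IntervalIntegrable q volume α β) :
    ∫ s in α..β, p s * ∫ r in s..β, q r = ∫ r in α..β, (∫ s in α..r, p s) * q r := by
  rw [intervalIntegrable_iff_integrableOn_Ioc_of_le hαβ] at hp hq
  set μ := volume.restrict (Set.Ioc α β) with hμ
  have hprod : Integrable (fun z : ℝ × ℝ => p z.1 * q z.2) (μ.prod μ) := hp.mul_prod hq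
  -- Both sides are integrals of `p s * q r` over the triangle `s < r`, in the two orders.
  have hset : MeasurableSet {z : ℝ × ℝ | z.1 < z.2} := measurableSet_lt measurable_fst measurable_snd
  have hind := hprod.indicator hset
  have hswap := integral_integral_swap
    (f := fun s r => {z : ℝ × ℝ | z.1 < z.2}.indicator (fun z => p z.1 * q z.2) (s, r)) hind
  rw [intervalIntegral.integral_of_le hαβ, intervalIntegral.integral_of_le hαβ]
  have h1 : ∀ s ∈ Set.Ioc α β, ∫ r, {z : ℝ × ℝ | z.1 < z.2}.indicator
      (fun z => p z.1 * q z.2) (s, r) ∂μ = p s * ∫ r in s..β, q r := by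
    intro s hs
    have : ∀ r, {z : ℝ × ℝ | z.1 < z.2}.indicator (fun z => p z.1 * q z.2) (s, r)
        = (Set.Ioi s).indicator (fun r => p s * q r) r := fun r => by
      simp [Set.indicator_apply]
    simp only [this]
    rw [integral_indicator measurableSet_Ioi, hμ, Measure.restrict_restrict measurableSet_Ioi,
      integral_const_mul, intervalIntegral.integral_of_le hs.2]
    congr 3
    ext r
    simp only [Set.mem_inter_iff, Set.mem_Ioi, Set.mem_Ioc]
    exact ⟨fun h => ⟨h.1, h.2.2⟩, fun h => ⟨h.1, hs.1.trans h.1, h.2⟩⟩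
  have h2 : ∀ r ∈ Set.Ioc α β, ∫ s, {z : ℝ × ℝ | z.1 < z.2}.indicator
      (fun z => p z.1 * q z.2) (s, r) ∂μ = (∫ s in α..r, p s) * q r := by
    intro r hr
    have : ∀ s, {z : ℝ × ℝ | z.1 < z.2}.indicator (fun z => p z.1 * q z.2) (s, r)
        = (Set.Iio r).indicator (fun s => p s * q r) s := fun s => by
      simp [Set.indicator_apply]
    simp only [this]
    rw [integral_indicator measurableSet_Iio, hμ, Measure.restrict_restrict measurableSet_Iio,
      integral_mul_const, intervalIntegral.integral_of_le hr.1.le, integral_Ioc_eq_integral_Ioo]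
    congr 3
    ext s
    simp only [Set.mem_inter_iff, Set.mem_Iio, Set.mem_Ioc, Set.mem_Ioo]
    exact ⟨fun h => ⟨h.2.1, h.1⟩, fun h => ⟨h.2, h.1, h.2.le.trans hr.2⟩⟩
  rw [setIntegral_congr_fun measurableSet_Ioc h1, setIntegral_congr_fun measurableSet_Ioc h2]
    at hswap
  exact hswap

section

variable {T : ℝ≥0} {a : ℝ} {f : ℝ≥0 → ℝ}

/-- The function `f` on `(0, T]`, extended by `0` to the real line. -/
noncomputable def cutoff (T : ℝ≥0) (f : ℝ≥0 → ℝ) : ℝ → ℝ :=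
  (Set.Ioc (0 : ℝ) T).indicator (fun t => f t.toNNReal)

/-- The function `s ↦ ∫_s^T e^{a (r - s)} f(r) dr`. -/
noncomputable def expTail (a : ℝ) (T : ℝ≥0) (f : ℝ≥0 → ℝ) (s : ℝ) : ℝ :=
  Real.exp (-(a * s)) * ∫ r in s..T, Real.exp (a * r) * cutoff T f r

/-- The solution `F` of the Volterra equation `F(s) = f(s) + a ∫_s^T F(r) dr`. -/
noncomputable def volterra (a : ℝ) (T : ℝ≥0) (f : ℝ≥0 → ℝ) (t : ℝ≥0) : ℝ :=
  f t + a * expTail a T f t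

lemma cutoff_of_mem {t : ℝ} (ht : t ∈ Set.Ioc (0 : ℝ) T) : cutoff T f t = f t.toNNReal :=
  Set.indicator_of_mem ht _

lemma cutoff_of_notMem {t : ℝ} (ht : t ∉ Set.Ioc (0 : ℝ) T) : cutoff T f t = 0 :=
  Set.indicator_of_notMem ht _

lemma abs_cutoff_le {C : ℝ} (hC : ∀ t ≤ T, |f t| ≤ C) (t : ℝ) : |cutoff T f t| ≤ C := by
  by_cases ht : t ∈ Set.Ioc (0 : ℝ) T
  · rw [cutoff_of_mem ht]; exact hC _ (toNNReal_le_of_mem_Ioc ht)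
  · rw [cutoff_of_notMem ht, abs_zero]; exact (abs_nonneg _).trans (hC 0 zero_le)

lemma IsAdmissible.measurable_cutoff (hf : IsAdmissible T f) : Measurable (cutoff T f) := by
  refine measurable_of_tendsto_metrizable (f := fun k => (TimePartition.uniform T k).leftStep f)
    (fun k => TimePartition.measurable_stepFn _ _) (tendsto_pi_nhds.2 fun t => ?_)
  by_cases ht : t ∈ Set.Ioc (0 : ℝ) T
  · rw [cutoff_of_mem ht]
    exact hf.tendsto_leftStep (TimePartition.tendsto_mesh_uniform T) ht
  · rw [cutoff_of_notMem ht]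
    simp only [TimePartition.leftStep, TimePartition.stepFn_eq_zero _ _ ht]
    exact tendsto_const_nhds

lemma IsAdmissible.intervalIntegrable_mul_cutoff (hf : IsAdmissible T f) {φ : ℝ → ℝ}
    (hφ : Continuous φ) (x y : ℝ) :
    IntervalIntegrable (fun r => φ r * cutoff T f r) volume x y := by
  obtain ⟨C, hC⟩ := hf.bdd
  refine IntervalIntegrable.continuousOn_mul ?_ hφ.continuousOn
  rw [intervalIntegrable_iff]
  exact Measure.integrableOn_of_bounded (M := C) (by simp [Set.uIoc])
    hf.measurable_cutoff.aestronglyMeasurable (Eventually.of_forall fun t => abs_cutoff_le hC t)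

lemma IsAdmissible.continuous_expTail (hf : IsAdmissible T f) : Continuous (expTail a T f) := by
  refine Continuous.mul (by fun_prop) ?_
  have h := intervalIntegral.continuous_primitive
    (f := fun r => Real.exp (a * r) * cutoff T f r)
    (fun x y => hf.intervalIntegrable_mul_cutoff (by fun_prop) x y) T
  have h2 : (fun s : ℝ => ∫ r in s..T, Real.exp (a * r) * cutoff T f r)
      = fun s : ℝ => - ∫ r in (T : ℝ)..s, Real.exp (a * r) * cutoff T f r := by
    ext s; rw [intervalIntegral.integral_symm]
  rw [h2]
  exact h.neg

/-- Extension by zero allows a fixed domain and the kernel `e^{ax}` independent of `s`: the tail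
becomes a mixture of translates of `f`, to which Fubini applies. -/
lemma expTail_eq_shift {s : ℝ} (hs0 : 0 ≤ s) (hsT : s ≤ T) :
    expTail a T f s = ∫ x in (0 : ℝ)..T, Real.exp (a * x) * cutoff T f (s + x) := by
  have hT : (0 : ℝ) ≤ T := T.2
  have h1 : ∫ r in s..T, Real.exp (a * r) * cutoff T f r
      = ∫ r in s..(T + s), Real.exp (a * r) * cutoff T f r := by
    rw [intervalIntegral.integral_of_le hsT, intervalIntegral.integral_of_le (by linarith)]
    refine setIntegral_eq_of_subset_of_forall_sdiff_eq_zero measurableSet_Ioc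
      (Set.Ioc_subset_Ioc_right (by linarith)) ?_ |>.symm
    rintro r ⟨hr, hr'⟩
    rw [cutoff_of_notMem, mul_zero]
    exact fun h => hr' ⟨hr.1, h.2⟩
  have h2 := intervalIntegral.integral_comp_add_left
    (fun r => Real.exp (a * r) * cutoff T f r) s (a := 0) (b := (T : ℝ))
  rw [expTail, h1, add_comm (T : ℝ) s]
  rw [add_zero] at h2
  rw [← h2, ← intervalIntegral.integral_const_mul]
  refine intervalIntegral.integral_congr fun x _ => ?_
  rw [← mul_assoc, ← Real.exp_add]
  congr 2
  ring

lemma integral_exp_mul (a x y : ℝ) : ∫ r in x..y, a * Real.exp (a * r)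
    = Real.exp (a * y) - Real.exp (a * x) := by
  have hc : Continuous fun r => a * Real.exp (a * r) := by fun_prop
  refine intervalIntegral.integral_eq_sub_of_hasDerivAt
    (f := fun r => Real.exp (a * r)) (fun r _ => ?_) (hc.intervalIntegrable _ _)
  have := ((hasDerivAt_id r).const_mul a).exp
  simpa [mul_comm] using this

/-- By Fubini, `∫_s^T a · expTail` equals `expTail` at `s` minus `∫_s^T f`; this makes `volterra` a
solution of its integral equation. -/
lemma expTail_eq_integral_volterra (hf : IsAdmissible T f) {s : ℝ} (hs0 : 0 ≤ s) (hsT : s ≤ T) :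
    expTail a T f s = ∫ r in s..T, volterra a T f r.toNNReal := by
  have hcut : ∫ r in s..T, volterra a T f r.toNNReal
      = ∫ r in s..T, (cutoff T f r + a * expTail a T f r) := by
    rw [intervalIntegral.integral_of_le hsT, intervalIntegral.integral_of_le hsT]
    refine setIntegral_congr_fun measurableSet_Ioc fun r hr => ?_
    have hr' : r ∈ Set.Ioc (0 : ℝ) T := ⟨hs0.trans_lt hr.1, hr.2⟩
    simp only [volterra]
    rw [cutoff_of_mem hr', Real.coe_toNNReal r hr'.1.le]
  have hi : IntervalIntegrable (cutoff T f) volume s T := by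
    simpa using hf.intervalIntegrable_mul_cutoff (φ := fun _ => 1) (by fun_prop) s T
  have hcont : Continuous (expTail a T f) := hf.continuous_expTail
  have hE : Continuous fun r => a * expTail a T f r := by fun_prop
  rw [hcut, intervalIntegral.integral_add hi (hE.intervalIntegrable _ _)]
  have hswap := integral_mul_integral_tail_eq hsT (p := fun r => a * Real.exp (-(a * r)))
    (q := fun r => Real.exp (a * r) * cutoff T f r)
    (Continuous.intervalIntegrable (by fun_prop) _ _)
    (hf.intervalIntegrable_mul_cutoff (by fun_prop) s T)
  have hl : ∫ r in s..T, a * expTail a T f r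
      = ∫ s in s..T, a * Real.exp (-(a * s)) * ∫ r in s..T, Real.exp (a * r) * cutoff T f r :=
    intervalIntegral.integral_congr fun r _ => by simp only [expTail]; ring
  have hr : ∀ r, (∫ ρ in s..r, a * Real.exp (-(a * ρ))) * (Real.exp (a * r) * cutoff T f r)
      = Real.exp (-(a * s)) * (Real.exp (a * r) * cutoff T f r) - cutoff T f r := by
    intro r
    have h := integral_exp_mul (-a) s r
    have h' : ∫ ρ in s..r, a * Real.exp (-(a * ρ)) = Real.exp (-(a * s)) - Real.exp (-(a * r)) := by
      have : ∀ ρ, a * Real.exp (-(a * ρ)) = -(-a * Real.exp (-a * ρ)) := fun ρ => by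
        rw [neg_mul a ρ]; ring
      simp only [this]
      rw [intervalIntegral.integral_neg, h, neg_mul, neg_mul]; ring
    rw [h']
    have : Real.exp (-(a * r)) * Real.exp (a * r) = 1 := by rw [← Real.exp_add]; simp
    linear_combination (-cutoff T f r) * this
  simp only [hr] at hswap
  rw [hl, hswap, intervalIntegral.integral_sub _ hi, intervalIntegral.integral_const_mul, expTail]
  · ring
  · exact (hf.intervalIntegrable_mul_cutoff (by fun_prop) s T).const_mul _

/-- The integral equals `1 - e^{aT}`. This is where `a ≤ 0` makes all later bounds independent of
`a`. -/
lemma integral_abs_mul_exp_le (ha : a ≤ 0) :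
    ∫ x in (0 : ℝ)..T, |a| * Real.exp (a * x) ≤ 1 := by
  have h := integral_exp_mul a 0 T
  rw [abs_of_nonpos ha]
  simp only [neg_mul]
  rw [intervalIntegral.integral_neg, h]
  simp [Real.exp_nonneg]

lemma abs_mul_expTail_le (ha : a ≤ 0) {C : ℝ} (hC : ∀ t ≤ T, |f t| ≤ C) {s : ℝ} (hs0 : 0 ≤ s)
    (hsT : s ≤ T) : |a * expTail a T f s| ≤ C := by
  have hC0 : 0 ≤ C := (abs_nonneg _).trans (hC 0 zero_le)
  rw [expTail_eq_shift hs0 hsT, ← intervalIntegral.integral_const_mul]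
  have h := intervalIntegral.norm_integral_le_of_norm_le (μ := volume) (a := 0) (b := (T : ℝ))
    (f := fun x => a * (Real.exp (a * x) * cutoff T f (s + x)))
    (g := fun x => |a| * Real.exp (a * x) * C) T.2
    (Eventually.of_forall fun x _ => by
      rw [Real.norm_eq_abs, abs_mul, abs_mul, abs_of_pos (Real.exp_pos _), ← mul_assoc]
      exact mul_le_mul_of_nonneg_left (abs_cutoff_le hC _) (by positivity))
    (Continuous.intervalIntegrable (by fun_prop) _ _)
  rw [Real.norm_eq_abs, intervalIntegral.integral_mul_const] at h
  refine h.trans ?_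
  have := mul_le_mul_of_nonneg_right (integral_abs_mul_exp_le (T := T) ha) hC0
  rwa [one_mul] at this

lemma abs_volterra_le (ha : a ≤ 0) {C : ℝ} (hC : ∀ t ≤ T, |f t| ≤ C) (t : ℝ≥0) (ht : t ≤ T) :
    |volterra a T f t| ≤ 2 * C := by
  have h := abs_mul_expTail_le ha hC (s := t) t.2 (by exact_mod_cast ht)
  rw [volterra, two_mul]
  exact (abs_add_le _ _).trans (add_le_add (hC t ht) h)

lemma IsAdmissible.volterra (ha : a ≤ 0) (hf : IsAdmissible T f) :
    IsAdmissible T (volterra a T f) := by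
  obtain ⟨C, hC⟩ := hf.bdd
  refine ⟨⟨2 * C, abs_volterra_le ha hC⟩, fun t ht => ?_⟩
  have hcont : Continuous (expTail a T f) := hf.continuous_expTail
  exact (hf.leftCont t ht).add
    (by fun_prop : Continuous fun t : ℝ≥0 => a * expTail a T f t).continuousWithinAt

lemma TimePartition.sum_mul_integral (π : TimePartition T) (c : ℕ → ℝ) {φ : ℝ → ℝ}
    (hφ : IntegrableOn φ (Set.Ioc (0 : ℝ) T)) :
    ∑ i ∈ Finset.range π.size, c i * ∫ r in (π.pt i : ℝ)..(π.pt (i + 1)), φ r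
      = ∫ r in Set.Ioc (0 : ℝ) T, π.stepFn c r * φ r := by
  simp only [TimePartition.stepFn, Finset.sum_mul]
  have hsub : ∀ i ∈ Finset.range π.size,
      Set.Ioc (π.pt i : ℝ) (π.pt (i + 1)) ⊆ Set.Ioc (0 : ℝ) T := fun i hi =>
    Set.Ioc_subset_Ioc (π.pt i).2 (by exact_mod_cast π.pt_le (Finset.mem_range.1 hi))
  have heq : ∀ i r, c i * (Set.Ioc (π.pt i : ℝ) (π.pt (i + 1))).indicator (fun _ => 1) r * φ r
      = c i * (Set.Ioc (π.pt i : ℝ) (π.pt (i + 1))).indicator φ r := fun i r => by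
    by_cases hr : r ∈ Set.Ioc (π.pt i : ℝ) (π.pt (i + 1)) <;> simp [hr]
  simp only [heq]
  rw [integral_finsetSum]
  · refine Finset.sum_congr rfl fun i hi => ?_
    rw [integral_const_mul, integral_indicator measurableSet_Ioc,
      Measure.restrict_restrict measurableSet_Ioc, Set.inter_eq_left.2 (hsub i hi),
      intervalIntegral.integral_of_le (by exact_mod_cast π.mono i.le_succ)]
  · intro i hi
    exact (hφ.indicator measurableSet_Ioc).const_mul _

lemma tendsto_integral_stepFn_mul {c : ℕ → ℕ → ℝ} {π : ℕ → TimePartition T} {C : ℝ}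
    (hC : ∀ k, ∀ i < (π k).size, |c k i| ≤ C) {L φ : ℝ → ℝ}
    (hφ : IntegrableOn φ (Set.Ioc (0 : ℝ) T))
    (h : ∀ t ∈ Set.Ioc (0 : ℝ) T, Tendsto (fun k => (π k).stepFn (c k) t) atTop (𝓝 (L t))) :
    Tendsto (fun k => ∫ r in Set.Ioc (0 : ℝ) T, (π k).stepFn (c k) r * φ r) atTop
      (𝓝 (∫ r in Set.Ioc (0 : ℝ) T, L r * φ r)) := by
  refine tendsto_integral_of_dominated_convergence (fun r => C * ‖φ r‖)
    (fun k => ((TimePartition.measurable_stepFn _ _).aestronglyMeasurable.mul hφ.1))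
    (hφ.norm.const_mul C) (fun k => ?_) ?_
  · filter_upwards [ae_restrict_mem measurableSet_Ioc] with t ht
    rw [norm_mul]
    exact mul_le_mul_of_nonneg_right ((π k).abs_stepFn_le _ (hC k) ht) (norm_nonneg _)
  · filter_upwards [ae_restrict_mem measurableSet_Ioc] with t ht
    exact (h t ht).mul_const _

/-- Pathwise, the elementary sums of `f` against a solution `x` of `dx = a x dt + du` and those of
`volterra a T f` against `u` have the same limits. -/
lemma tendsto_elementary_sum_sub (ha : a ≤ 0) (hf : IsAdmissible T f) {x u : ℝ≥0 → ℝ}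
    (hu0 : u 0 = 0) (hub : ∃ B : ℝ, ∀ t ≤ T, |u t| ≤ B)
    (hur : ∀ t, ContinuousWithinAt u (Set.Ici t) t)
    (hx : ∀ t : ℝ≥0, IntervalIntegrable (fun s : ℝ => x s.toNNReal) volume 0 (t : ℝ) ∧
      x t = a * (∫ s in (0 : ℝ)..(t : ℝ), x s.toNNReal) + u t)
    {π : ℕ → TimePartition T} (hπ : Tendsto (fun k => (π k).mesh) atTop (𝓝 0)) :
    Tendsto (fun k => ∑ i ∈ Finset.range (π k).size,
        f ((π k).pt i) * (x ((π k).pt (i + 1)) - x ((π k).pt i))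
      - ∑ i ∈ Finset.range (π k).size,
        volterra a T f ((π k).pt i) * (u ((π k).pt (i + 1)) - u ((π k).pt i))) atTop (𝓝 0) := by
  have hT : (0 : ℝ) ≤ T := T.2
  obtain ⟨C, hC⟩ := hf.bdd
  obtain ⟨B, hB⟩ := hub
  have hF := hf.volterra ha
  obtain ⟨D, hD⟩ := hF.bdd
  set F := _root_.volterra a T f with hFdef
  set xr : ℝ → ℝ := fun s => x s.toNNReal with hxr
  set Fr : ℝ → ℝ := fun s => F s.toNNReal with hFr
  have hxi : IntegrableOn xr (Set.Ioc (0 : ℝ) T) :=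
    (intervalIntegrable_iff_integrableOn_Ioc_of_le hT).1 (hx T).1
  have hFi : IntegrableOn Fr (Set.Ioc (0 : ℝ) T) := by
    simpa using hF.integrable_mul_pow hF 1 0
  have hxi' : IntegrableOn xr (Set.Icc (0 : ℝ) T) := by
    rwa [integrableOn_Icc_iff_integrableOn_Ioc]
  have hFi' : IntegrableOn Fr (Set.Icc (0 : ℝ) T) := by
    rwa [integrableOn_Icc_iff_integrableOn_Ioc]
  have hFint : ∀ s t : ℝ≥0, s ≤ t → t ≤ T → IntervalIntegrable Fr volume s t := by
    intro s t hst htT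
    rw [intervalIntegrable_iff_integrableOn_Ioc_of_le (by exact_mod_cast hst)]
    exact hFi.mono_set (Set.Ioc_subset_Ioc s.2 (by exact_mod_cast htT))
  have hH : ∀ t : ℝ≥0, t ≤ T → F t = f t + a * ∫ r in (t : ℝ)..T, Fr r := by
    intro t ht
    rw [hFdef, volterra, expTail_eq_integral_volterra hf (s := (t : ℝ)) t.2 (by exact_mod_cast ht)]
  have hxsub : ∀ s t : ℝ≥0, s ≤ t → x t - x s = a * (∫ r in (s : ℝ)..t, xr r) + (u t - u s) := by
    intro s t hst
    rw [(hx t).2, (hx s).2, ← intervalIntegral.integral_interval_sub_left (hx t).1 (hx s).1]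
    ring
  have hsum : ∀ k, ∑ i ∈ Finset.range (π k).size,
        f ((π k).pt i) * (x ((π k).pt (i + 1)) - x ((π k).pt i))
      - ∑ i ∈ Finset.range (π k).size, F ((π k).pt i) * (u ((π k).pt (i + 1)) - u ((π k).pt i))
      = a * (∫ r in Set.Ioc (0 : ℝ) T, (π k).leftStep f r * xr r)
        - a * (∫ r in Set.Ioc (0 : ℝ) T, (π k).stepFn (fun i => u ((π k).pt (i + 1))) r * Fr r) := by
    intro k
    rw [← (π k).sum_mul_integral _ hxi, ← (π k).sum_mul_integral _ hFi]
    set p := (π k).pt with hp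
    -- The boundary term `(∫_t^T F) u(t)` vanishes at `0` because `u 0 = 0`, and at `T` because the
    -- integral is empty.
    have htel : ∑ i ∈ Finset.range (π k).size,
        ((∫ r in (p (i + 1) : ℝ)..T, Fr r) * u (p (i + 1)) - (∫ r in (p i : ℝ)..T, Fr r) * u (p i))
        = 0 := by
      rw [Finset.sum_range_sub (fun i => (∫ r in (p i : ℝ)..T, Fr r) * u (p i))]
      rw [hp, (π k).pt_zero, (π k).pt_size, hu0]
      simp
    -- Summation by parts: `f - F = -a ∫_t^T F` is moved off the increment of `u`, which leaves `u`
    -- at the right endpoint of each cell, where its right continuity is usable.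
    have hterm : ∀ i ∈ Finset.range (π k).size,
        f (p i) * (x (p (i + 1)) - x (p i)) - F (p i) * (u (p (i + 1)) - u (p i))
        = a * (f (p i) * ∫ r in (p i : ℝ)..(p (i + 1)), xr r)
          - a * (u (p (i + 1)) * ∫ r in (p i : ℝ)..(p (i + 1)), Fr r)
          - a * ((∫ r in (p (i + 1) : ℝ)..T, Fr r) * u (p (i + 1))
            - (∫ r in (p i : ℝ)..T, Fr r) * u (p i)) := by
      intro i hi
      have hi1 : p (i + 1) ≤ T := (π k).pt_le (Finset.mem_range.1 hi)
      have hi0 : p i ≤ p (i + 1) := (π k).mono i.le_succ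
      rw [hxsub _ _ hi0, hH _ (hi0.trans hi1),
        ← intervalIntegral.integral_add_adjacent_intervals (hFint _ _ hi0 hi1)
          (hFint _ T hi1 le_rfl)]
      ring
    rw [← Finset.sum_sub_distrib, Finset.sum_congr rfl hterm, Finset.sum_sub_distrib,
      Finset.sum_sub_distrib, ← Finset.mul_sum, ← Finset.mul_sum, ← Finset.mul_sum, htel]
    ring
  have hlim1 := tendsto_integral_stepFn_mul (π := π) (c := fun k i => f ((π k).pt i)) (C := C)
    (L := fun t => f t.toNNReal) (fun k i hi => hC _ ((π k).pt_le hi.le)) hxi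
    (fun t ht => hf.tendsto_leftStep hπ ht)
  have hlim2 := tendsto_integral_stepFn_mul (π := π) (c := fun k i => u ((π k).pt (i + 1))) (C := B)
    (L := fun t => u t.toNNReal) (fun k i hi => hB _ ((π k).pt_le hi)) hFi
    (fun t _ => TimePartition.tendsto_stepFn_right hπ (by assumption) (hur _))
  have hlim := (hlim1.const_mul a).sub (hlim2.const_mul a)
  simp only [hsum]
  refine hlim.congr' (Eventually.of_forall fun _ => rfl) |>.trans (le_of_eq ?_)
  congr 1
  -- The limit is `a (∫ f x - ∫ u F)`. Substituting `f = F - a ∫_t^T F` and `u = x - a X`, with `X`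
  -- the primitive of `x`, both integrals become `∫ F x - a ∫ X F`, by Fubini on the triangle.
  set X : ℝ → ℝ := fun r => ∫ s in (0 : ℝ)..r, xr s with hX
  have hFm := hF.aemeasurable
  have hxF : IntegrableOn (fun r => Fr r * xr r) (Set.Ioc (0 : ℝ) T) :=
    hxi.bdd_mul hFm.aestronglyMeasurable (c := D) (by
      filter_upwards [ae_restrict_mem measurableSet_Ioc] with t ht
      exact hD _ (toNNReal_le_of_mem_Ioc ht))
  have hXc : ContinuousOn X (Set.Icc 0 T) := by
    have := intervalIntegral.continuousOn_primitive_interval (a := 0) (b := (T : ℝ)) (f := xr)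
      (μ := volume) (by rw [Set.uIcc_of_le hT]; exact hxi')
    rwa [Set.uIcc_of_le hT] at this
  have hXF : IntegrableOn (fun r => X r * Fr r) (Set.Ioc (0 : ℝ) T) :=
    (hFi'.continuousOn_mul hXc isCompact_Icc).mono_set
      Set.Ioc_subset_Icc_self
  have e2 : ∫ r in Set.Ioc (0 : ℝ) T, u r.toNNReal * Fr r
      = (∫ r in Set.Ioc (0 : ℝ) T, Fr r * xr r) - a * ∫ r in Set.Ioc (0 : ℝ) T, X r * Fr r := by
    rw [← integral_const_mul, ← integral_sub hxF (hXF.const_mul a)]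
    refine setIntegral_congr_fun measurableSet_Ioc fun r hr => ?_
    have h := (hx r.toNNReal).2
    rw [Real.coe_toNNReal r hr.1.le] at h
    have h' : u r.toNNReal = xr r - a * X r := by simp only [hxr, hX]; linarith
    simp only [h']
    ring
  have e1 : ∫ r in Set.Ioc (0 : ℝ) T, f r.toNNReal * xr r
      = (∫ r in Set.Ioc (0 : ℝ) T, Fr r * xr r)
        - a * ∫ r in Set.Ioc (0 : ℝ) T, X r * Fr r := by
    have hsw := integral_mul_integral_tail_eq hT (hx T).1 (hFint 0 T zero_le le_rfl)
    rw [intervalIntegral.integral_of_le hT, intervalIntegral.integral_of_le hT] at hsw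
    have htail : IntegrableOn (fun s => xr s * ∫ r in s..T, Fr r) (Set.Ioc (0 : ℝ) T) := by
      have hc : ContinuousOn (fun s => ∫ r in s..T, Fr r) (Set.Icc (0 : ℝ) T) := by
        have := intervalIntegral.continuousOn_primitive_interval_left (a := 0) (b := (T : ℝ))
          (f := Fr) (μ := volume)
          (by rw [Set.uIcc_of_le hT]; exact hFi')
        rwa [Set.uIcc_of_le hT] at this
      exact (hxi'.mul_continuousOn hc
        isCompact_Icc).mono_set Set.Ioc_subset_Icc_self
    rw [← hsw, ← integral_const_mul, ← integral_sub hxF (htail.const_mul a)]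
    refine setIntegral_congr_fun measurableSet_Ioc fun r hr => ?_
    have h := hH r.toNNReal (toNNReal_le_of_mem_Ioc hr)
    rw [Real.coe_toNNReal r hr.1.le] at h
    simp only [hFr, h]
    ring
  rw [e1, e2, sub_self]

end

/-! ### Bounds on the transformed integrands by `‖·‖_*` and `ϖ*`. -/

section

variable {T : ℝ≥0} {a : ℝ} {f g : ℝ≥0 → ℝ}

/-- `volterra` averages the translates of `f` against a signed measure of total mass at most `2`:
the unit mass at shift `0` plus `a e^{ax} dx`. A bound uniform in the shift therefore survives with
a factor `2`. -/
lemma abs_integral_volterra_mul_le (ha : a ≤ 0) (hf : IsAdmissible T f) {p : ℝ → ℝ}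
    (hp : IntegrableOn p (Set.Ioc (0 : ℝ) T)) {B : ℝ}
    (hB : ∀ x ∈ Set.Icc (0 : ℝ) T, |∫ s in Set.Ioc (0 : ℝ) T, cutoff T f (s + x) * p s| ≤ B) :
    |∫ s in Set.Ioc (0 : ℝ) T, volterra a T f s.toNNReal * p s| ≤ 2 * B := by
  have hT : (0 : ℝ) ≤ T := T.2
  obtain ⟨C, hC⟩ := hf.bdd
  have hB0 : 0 ≤ B := (abs_nonneg _).trans (hB 0 ⟨le_rfl, hT⟩)
  have hm := hf.measurable_cutoff
  set μ := volume.restrict (Set.Ioc (0 : ℝ) T) with hμ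
  have hp' : Integrable p μ := hp
  have i1 : Integrable (fun s => cutoff T f (s + 0) * p s) μ :=
    hp'.bdd_mul (hm.comp (by fun_prop : Measurable fun s : ℝ => s + 0)).aestronglyMeasurable
      (Eventually.of_forall fun s => abs_cutoff_le hC _)
  have hker : Measurable (fun z : ℝ × ℝ => a * Real.exp (a * z.2) * cutoff T f (z.1 + z.2)) := by
    have h := hm.comp (by fun_prop : Measurable fun z : ℝ × ℝ => z.1 + z.2)
    exact Measurable.mul (by fun_prop) h
  have i2 : Integrable
      (fun z : ℝ × ℝ => a * Real.exp (a * z.2) * cutoff T f (z.1 + z.2) * p z.1) (μ.prod μ) := by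
    refine (hp'.comp_fst μ).bdd_mul (c := |a| * 1 * C) hker.aestronglyMeasurable ?_
    have hz : ∀ᵐ z ∂(μ.prod μ), z.2 ∈ Set.Ioc (0 : ℝ) T :=
      Measure.quasiMeasurePreserving_snd.ae (ae_restrict_mem measurableSet_Ioc)
    filter_upwards [hz] with z hz
    rw [Real.norm_eq_abs, abs_mul, abs_mul, abs_of_pos (Real.exp_pos _)]
    have h1 : Real.exp (a * z.2) ≤ 1 :=
      Real.exp_le_one_iff.2 (mul_nonpos_of_nonpos_of_nonneg ha hz.1.le)
    have h2 := abs_cutoff_le hC (z.1 + z.2)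
    gcongr
  have hsplit : ∫ s, volterra a T f s.toNNReal * p s ∂μ = (∫ s, cutoff T f (s + 0) * p s ∂μ)
      + ∫ s, ∫ x, a * Real.exp (a * x) * cutoff T f (s + x) * p s ∂μ ∂μ := by
    rw [← integral_add i1 i2.integral_prod_left]
    refine setIntegral_congr_fun measurableSet_Ioc fun s hs => ?_
    simp only
    rw [volterra, Real.coe_toNNReal s hs.1.le, expTail_eq_shift hs.1.le hs.2, add_zero,
      cutoff_of_mem hs, integral_mul_const, intervalIntegral.integral_of_le hT,
      ← integral_const_mul, ← add_mul]
    simp only [mul_assoc]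
    rfl
  rw [hsplit, integral_integral_swap i2]
  have hinner : ∀ x, ∫ s, a * Real.exp (a * x) * cutoff T f (s + x) * p s ∂μ
      = a * Real.exp (a * x) * ∫ s, cutoff T f (s + x) * p s ∂μ := fun x => by
    rw [← integral_const_mul]; simp only [mul_assoc]
  simp only [hinner]
  have hcont : Continuous fun x => |a| * Real.exp (a * x) * B := by fun_prop
  have hbound : ‖∫ x, a * Real.exp (a * x) * ∫ s, cutoff T f (s + x) * p s ∂μ ∂μ‖ ≤ B := by
    refine (norm_integral_le_of_norm_le (g := fun x => |a| * Real.exp (a * x) * B) ?_ ?_).trans ?_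
    · exact (intervalIntegrable_iff_integrableOn_Ioc_of_le hT).1 (hcont.intervalIntegrable _ _)
    · filter_upwards [ae_restrict_mem measurableSet_Ioc] with x hx
      rw [Real.norm_eq_abs, abs_mul, abs_mul, abs_of_pos (Real.exp_pos _)]
      exact mul_le_mul_of_nonneg_left (hB x ⟨hx.1.le, hx.2⟩) (by positivity)
    · rw [hμ, ← intervalIntegral.integral_of_le hT, intervalIntegral.integral_mul_const]
      have := mul_le_mul_of_nonneg_right (integral_abs_mul_exp_le (T := T) ha) hB0
      rwa [one_mul] at this
  rw [two_mul]
  exact (abs_add_le _ _).trans (add_le_add (hB 0 ⟨le_rfl, hT⟩) hbound)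

lemma le_starNorm {C : ℝ} (hC : ∀ t ≤ T, |f t| ≤ C) {t : ℝ≥0} (ht : t ≤ T) :
    |f t| ≤ starNorm T f :=
  le_csSup ⟨C, by rintro _ ⟨s, hs, rfl⟩; exact hC s hs⟩ ⟨t, ht, rfl⟩

lemma IsAdmissible.abs_le_starNorm (hf : IsAdmissible T f) {t : ℝ≥0} (ht : t ≤ T) :
    |f t| ≤ starNorm T f := by
  obtain ⟨C, hC⟩ := hf.bdd
  exact le_starNorm hC ht

/-- The bounds on `f` and `g` keep the set in `corr` bounded, without which `sSup` would not
dominate its members. -/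
lemma abs_integral_shift_le_corr {C D : ℝ} (hC : ∀ t ≤ T, |f t| ≤ C) (hD : ∀ t ≤ T, |g t| ≤ D)
    {v t : ℝ≥0} (hvt : v + t ≤ T) :
    |∫ u in (0 : ℝ)..t, f (u.toNNReal + v) * g u.toNNReal| ≤ corr T f g := by
  have hC0 : 0 ≤ C := (abs_nonneg _).trans (hC 0 zero_le)
  have hD0 : 0 ≤ D := (abs_nonneg _).trans (hD 0 zero_le)
  refine le_csSup ⟨C * D * T, ?_⟩ ⟨v, t, hvt, rfl⟩
  rintro _ ⟨v, t, hvt, rfl⟩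
  have htT : t ≤ T := le_add_self.trans hvt
  have h := intervalIntegral.norm_integral_le_of_norm_le_const (a := 0) (b := (t : ℝ)) (C := C * D)
    (f := fun u : ℝ => f (u.toNNReal + v) * g u.toNNReal) (by
      intro u hu
      rw [Set.uIoc_of_le t.coe_nonneg] at hu
      have hut : u.toNNReal ≤ t := toNNReal_le_of_mem_Ioc hu
      rw [norm_mul]
      refine mul_le_mul (hC _ ?_) (hD _ (hut.trans htT)) (norm_nonneg _) hC0
      exact le_trans (by rw [add_comm]; gcongr) hvt)
  rw [sub_zero, abs_of_nonneg t.coe_nonneg] at h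
  exact h.trans (mul_le_mul_of_nonneg_left (by exact_mod_cast htT) (by positivity))

/-- Only the difference `v = y - x` of the shifts matters after translation. The product vanishes
beyond `T - v`, so the integral is a difference of two integrals started at `0`, each bounded by
`corr`; hence the factor `2`. -/
lemma abs_integral_cutoff_shift_le (hf : IsAdmissible T f) (hg : IsAdmissible T g) {x y : ℝ}
    (hx : 0 ≤ x) (hxy : x ≤ y) (hyT : y ≤ T) :
    |∫ s in Set.Ioc (0 : ℝ) T, cutoff T f (s + x) * cutoff T g (s + y)| ≤ 2 * corr T g f := by
  have hT : (0 : ℝ) ≤ T := T.2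
  obtain ⟨C, hC⟩ := hf.bdd
  obtain ⟨D, hD⟩ := hg.bdd
  have hcorr := fun {v t : ℝ≥0} (hvt : v + t ≤ T) => abs_integral_shift_le_corr hD hC hvt
  have hcorr0 : 0 ≤ corr T g f := (abs_nonneg _).trans (hcorr (v := 0) (t := 0) (by simp))
  set v := y - x with hv
  set φ : ℝ → ℝ := fun r => cutoff T f r * cutoff T g (r + v) with hφ
  have hφi : ∀ α β, IntervalIntegrable φ volume α β := by
    intro α β
    have hm : Measurable φ := hf.measurable_cutoff.mul
      (hg.measurable_cutoff.comp (by fun_prop : Measurable fun r : ℝ => r + v))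
    rw [intervalIntegrable_iff]
    refine Measure.integrableOn_of_bounded (M := C * D) (by simp [Set.uIoc])
      hm.aestronglyMeasurable (Eventually.of_forall fun r => ?_)
    rw [norm_mul]
    exact mul_le_mul (abs_cutoff_le hC _) (abs_cutoff_le hD _) (norm_nonneg _)
      ((abs_nonneg _).trans (abs_cutoff_le hC 0))
  have hshift : ∫ s in Set.Ioc (0 : ℝ) T, cutoff T f (s + x) * cutoff T g (s + y)
      = ∫ r in x..(T + x), φ r := by
    have h := intervalIntegral.integral_comp_add_right φ x (a := 0) (b := (T : ℝ))
    rw [zero_add] at h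
    rw [← h, intervalIntegral.integral_of_le hT]
    refine integral_congr_ae (Eventually.of_forall fun s => ?_)
    simp only [hφ, hv]
    congr 2; ring
  have hprim : ∀ t : ℝ, 0 ≤ t → t ≤ T - v → |∫ r in (0 : ℝ)..t, φ r| ≤ corr T g f := by
    intro t ht htv
    have hv0 : 0 ≤ v := sub_nonneg.2 hxy
    have h := hcorr (v := v.toNNReal) (t := t.toNNReal) (by
      rw [← Real.toNNReal_add hv0 ht]
      exact Real.toNNReal_le_iff_le_coe.2 (by linarith))
    rw [Real.coe_toNNReal t ht] at h
    convert h using 2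
    rw [intervalIntegral.integral_of_le ht, intervalIntegral.integral_of_le ht]
    refine setIntegral_congr_fun measurableSet_Ioc fun r hr => ?_
    simp only [hφ]
    rw [cutoff_of_mem ⟨hr.1, by linarith [hr.2]⟩,
      cutoff_of_mem (t := r + v) ⟨by linarith [hr.1], by linarith [hr.2]⟩,
      Real.toNNReal_add hr.1.le hv0, mul_comm]
  have hzero : ∀ α β : ℝ, T - v ≤ α → α ≤ β → ∫ r in α..β, φ r = 0 := by
    intro α β hα hαβ
    rw [intervalIntegral.integral_of_le hαβ]
    refine setIntegral_eq_zero_of_forall_eq_zero fun r hr => ?_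
    simp only [hφ]
    rw [cutoff_of_notMem (f := g), mul_zero]
    exact fun h => by linarith [h.2, hr.1]
  rw [hshift]
  rcases le_total x (T - v) with h | h
  · have e : ∫ r in x..(T + x), φ r
        = (∫ r in (0 : ℝ)..(T - v), φ r) - ∫ r in (0 : ℝ)..x, φ r := by
      rw [intervalIntegral.integral_interval_sub_left (hφi _ _) (hφi _ _),
        ← intervalIntegral.integral_add_adjacent_intervals (hφi x (T - v)) (hφi (T - v) (T + x)),
        hzero (T - v) (T + x) le_rfl (by linarith), add_zero]
    rw [e, two_mul]
    exact (abs_sub _ _).trans (add_le_add (hprim _ (by linarith) le_rfl) (hprim _ hx h))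
  · rw [hzero x _ h (by linarith), abs_zero]
    positivity

lemma abs_integral_volterra_mul_volterra_le (ha : a ≤ 0) (hf : IsAdmissible T f)
    (hg : IsAdmissible T g) :
    |∫ s in Set.Ioc (0 : ℝ) T, volterra a T f s.toNNReal * volterra a T g s.toNNReal|
      ≤ 8 * corrStar T f g := by
  have hG := hg.volterra ha
  have hGi : IntegrableOn (fun s : ℝ => volterra a T g s.toNNReal) (Set.Ioc (0 : ℝ) T) := by
    simpa using hG.integrable_mul_pow hG 1 0
  obtain ⟨C, hC⟩ := hf.bdd
  -- The factor `8` is `2 · 2 · 2`: one `2` for each of the two transforms and one for the doubly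
  -- shifted integral.
  have key := abs_integral_volterra_mul_le ha hf hGi (B := 2 * (2 * corrStar T f g)) ?_
  · linarith
  intro x hx
  have hfi : IntegrableOn (fun s => cutoff T f (s + x)) (Set.Ioc (0 : ℝ) T) :=
    Measure.integrableOn_of_bounded (M := C) (by simp)
      (hf.measurable_cutoff.comp (by fun_prop : Measurable fun r : ℝ => r + x)).aestronglyMeasurable
      (Eventually.of_forall fun r => abs_cutoff_le hC _)
  have h := abs_integral_volterra_mul_le ha hg hfi (B := 2 * corrStar T f g) ?_
  · simpa only [mul_comm] using h
  intro y hy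
  -- Which function carries the larger shift decides between the two correlations, hence their
  -- maximum `corrStar`.
  rcases le_total x y with hxy | hxy
  · have h := abs_integral_cutoff_shift_le hf hg hx.1 hxy hy.2
    simp only [mul_comm (cutoff T g _)]
    exact h.trans (mul_le_mul_of_nonneg_left (le_max_right _ _) (by norm_num))
  · have h := abs_integral_cutoff_shift_le hg hf hy.1 hxy hx.2
    exact h.trans (mul_le_mul_of_nonneg_left (le_max_left _ _) (by norm_num))

lemma abs_setIntegral_le_const_mul {φ : ℝ → ℝ} {C : ℝ} (h : ∀ t ∈ Set.Ioc (0 : ℝ) T, |φ t| ≤ C) :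
    |∫ t in Set.Ioc (0 : ℝ) T, φ t| ≤ C * T := by
  have := norm_setIntegral_le_of_norm_le_const (μ := volume) (s := Set.Ioc (0 : ℝ) T)
    (f := φ) (C := C) (by simp) h
  simpa using this

end

/-! ### Transfer of the stochastic integral between `ξ` and the driving noise. -/

section

variable {Ω : Type*} [MeasurableSpace Ω] {P : Measure Ω}

lemma TendstoInMeasure.add_of_tendsto_ae [IsFiniteMeasure P] {X R : ℕ → Ω → ℝ} {J : Ω → ℝ}
    (hX : TendstoInMeasure P X atTop J) (hRm : ∀ k, AEStronglyMeasurable (R k) P)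
    (hR : ∀ᵐ ω ∂P, Tendsto (fun k => R k ω) atTop (𝓝 0)) :
    TendstoInMeasure P (fun k => X k + R k) atTop J := by
  have hR' : TendstoInMeasure P R atTop (fun _ => 0) := tendstoInMeasure_of_tendsto_ae hRm hR
  rw [tendstoInMeasure_iff_dist] at hX hR' ⊢
  intro ε hε
  have h := (hX (ε / 2) (half_pos hε)).add (hR' (ε / 2) (half_pos hε))
  rw [add_zero] at h
  refine tendsto_of_tendsto_of_tendsto_of_le_of_le tendsto_const_nhds h (fun _ => zero_le)
    fun k => ?_
  refine (measure_mono ?_).trans (measure_union_le _ _)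
  intro ω hω
  simp only [Set.mem_union, Set.mem_ofPred_eq, Pi.add_apply, Real.dist_eq, sub_zero] at hω ⊢
  by_contra hcon
  push Not at hcon
  have : X k ω + R k ω - J ω = (X k ω - J ω) + R k ω := by ring
  rw [this] at hω
  linarith [abs_add_le (X k ω - J ω) (R k ω)]

variable {a ρ₁ ρ₂ : ℝ} {lam : ℝ≥0} {w : ℝ≥0 → Ω → ℝ} {N : ℝ≥0 → Ω → ℕ}
  {Y : ℕ → Ω → ℝ} {ξ : ℝ≥0 → Ω → ℝ}

lemma IsOUNoise.measurable_drivingNoise (h : IsOUNoise P a ρ₁ ρ₂ lam w N Y ξ) (t : ℝ≥0) :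
    Measurable (drivingNoise ρ₁ ρ₂ w N Y t) :=
  ((h.measurable_w t).const_mul ρ₁).add
    ((measurable_compoundSum h.poisson.measurable h.measurable_Y t).const_mul ρ₂)

lemma IsOUNoise.ae_drivingNoise_path (h : IsOUNoise P a ρ₁ ρ₂ lam w N Y ξ) (T : ℝ≥0) :
    ∀ᵐ ω ∂P, drivingNoise ρ₁ ρ₂ w N Y 0 ω = 0 ∧
      (∃ B : ℝ, ∀ t ≤ T, |drivingNoise ρ₁ ρ₂ w N Y t ω| ≤ B) ∧
      ∀ t, ContinuousWithinAt (fun s => drivingNoise ρ₁ ρ₂ w N Y s ω) (Set.Ici t) t := by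
  filter_upwards [h.brownian.toIsPreBrownianReal.eval_zero_ae_eq_zero, h.brownian.cont,
    h.poisson.start, h.poisson.mono, h.poisson.rightCont] with ω hw0 hwc hN0 hNm hNr
  refine ⟨by simp [drivingNoise, compoundSum, hw0, hN0], ?_, fun t => ?_⟩
  · obtain ⟨B, hB⟩ := (isCompact_Icc (a := (0 : ℝ≥0)) (b := T)).exists_bound_of_continuousOn
      hwc.continuousOn
    -- Counts up to time `T` never exceed `N T ω`, so the jump part is dominated by the total
    -- absolute size of the marks used by then.
    refine ⟨|ρ₁| * B + |ρ₂| * ∑ j ∈ Finset.range (N T ω), |Y j ω|, fun t ht => ?_⟩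
    have hz : |compoundSum N Y t ω| ≤ ∑ j ∈ Finset.range (N T ω), |Y j ω| :=
      (Finset.abs_sum_le_sum_abs _ _).trans (Finset.sum_le_sum_of_subset_of_nonneg
        (Finset.range_mono (hNm ht)) fun _ _ _ => abs_nonneg _)
    refine (abs_add_le _ _).trans (add_le_add ?_ ?_)
    · rw [abs_mul]
      exact mul_le_mul_of_nonneg_left (hB t ⟨zero_le, ht⟩) (abs_nonneg _)
    · rw [abs_mul]
      exact mul_le_mul_of_nonneg_left hz (abs_nonneg _)
  · have hc : Continuous fun m : ℕ => ∑ j ∈ Finset.range m, Y j ω := continuous_of_discreteTopology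
    have h2 : ContinuousWithinAt (fun s => compoundSum N Y s ω) (Set.Ici t) t :=
      hc.continuousAt.comp_continuousWithinAt (hNr t)
    exact (hwc.continuousWithinAt.const_mul ρ₁).add (h2.const_mul ρ₂)

lemma IsOUNoise.ae_tendsto_elemIntegral_sub (h : IsOUNoise P a ρ₁ ρ₂ lam w N Y ξ) {T : ℝ≥0}
    {f : ℝ≥0 → ℝ} (hf : IsAdmissible T f) {π : ℕ → TimePartition T}
    (hπ : Tendsto (fun k => (π k).mesh) atTop (𝓝 0)) :
    ∀ᵐ ω ∂P, Tendsto (fun k => elemIntegral ξ f (π k) ω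
      - elemIntegral (drivingNoise ρ₁ ρ₂ w N Y) (volterra a T f) (π k) ω) atTop (𝓝 0) := by
  filter_upwards [h.ae_drivingNoise_path T, h.equation] with ω hu hξ
  exact tendsto_elementary_sum_sub h.a_nonpos hf (x := fun t => ξ t ω)
    (u := fun t => drivingNoise ρ₁ ρ₂ w N Y t ω) hu.1 hu.2.1 hu.2.2 hξ hπ

lemma measurable_elemIntegral {X : ℝ≥0 → Ω → ℝ} (hX : ∀ t, Measurable (X t)) (f : ℝ≥0 → ℝ)
    {T : ℝ≥0} (π : TimePartition T) : Measurable (elemIntegral X f π) := by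
  unfold elemIntegral
  fun_prop

variable [IsProbabilityMeasure P]

lemma IsOUNoise.isStochIntegral_iff (h : IsOUNoise P a ρ₁ ρ₂ lam w N Y ξ) {T : ℝ≥0}
    {f : ℝ≥0 → ℝ} (hf : IsAdmissible T f) (J : Ω → ℝ) :
    IsStochIntegral P ξ f T J
      ↔ IsStochIntegral P (drivingNoise ρ₁ ρ₂ w N Y) (volterra a T f) T J := by
  have mξ := fun (π : TimePartition T) => measurable_elemIntegral h.measurable_ξ f π
  have mu := fun (π : TimePartition T) =>
    measurable_elemIntegral h.measurable_drivingNoise (volterra a T f) π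
  constructor
  · rintro ⟨hJ, hlim⟩
    refine ⟨hJ, fun π hπ => ?_⟩
    have := TendstoInMeasure.add_of_tendsto_ae (hlim π hπ)
      (R := fun k ω => elemIntegral (drivingNoise ρ₁ ρ₂ w N Y) (volterra a T f) (π k) ω
        - elemIntegral ξ f (π k) ω)
      (fun k => ((mu (π k)).sub (mξ (π k))).aestronglyMeasurable) (by
        filter_upwards [h.ae_tendsto_elemIntegral_sub hf hπ] with ω hω
        simpa using hω.neg)
    exact this.congr_left fun k => Eventually.of_forall fun ω => by simp
  · rintro ⟨hJ, hlim⟩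
    refine ⟨hJ, fun π hπ => ?_⟩
    have := TendstoInMeasure.add_of_tendsto_ae (hlim π hπ)
      (R := fun k ω => elemIntegral ξ f (π k) ω
        - elemIntegral (drivingNoise ρ₁ ρ₂ w N Y) (volterra a T f) (π k) ω)
      (fun k => ((mξ (π k)).sub (mu (π k))).aestronglyMeasurable)
      (h.ae_tendsto_elemIntegral_sub hf hπ)
    exact this.congr_left fun k => Eventually.of_forall fun ω => by simp

/-- A limit in probability is almost surely unique, so any version of the integral coincides with
the `L⁴` limit and inherits its fourth moment. -/
lemma IsOUNoise.isL4Integral_of_isStochIntegral (h : IsOUNoise P a ρ₁ ρ₂ lam w N Y ξ) {T : ℝ≥0}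
    {f : ℝ≥0 → ℝ} (hf : IsAdmissible T f) {J : Ω → ℝ} (hJ : IsStochIntegral P ξ f T J) :
    IsL4Integral P (drivingNoise ρ₁ ρ₂ w N Y) (volterra a T f) T J := by
  obtain ⟨K, hK⟩ := h.hasStepMoments.exists_isL4Integral (hf.volterra h.a_nonpos)
  have hm := TimePartition.tendsto_mesh_uniform T
  have hJK : K =ᵐ[P] J := tendstoInMeasure_ae_unique
    ((hK.isStochIntegral h.hasStepMoments).2 _ hm) (((h.isStochIntegral_iff hf J).1 hJ).2 _ hm)
  refine ⟨(memLp_congr_ae hJK).1 hK.memLp, fun π hπ => ?_⟩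
  refine (hK.tendsto π hπ).congr fun k => eLpNorm_congr_ae ?_
  filter_upwards [hJK] with ω hω
  simp [hω]

end

/-! ### The covariance of the squares and the final estimate. -/

lemma integral_centeredSq_mul {Ω : Type*} [MeasurableSpace Ω] {P : Measure Ω}
    [IsProbabilityMeasure P] {J K : Ω → ℝ} (hJ : MemLp J 4 P) (hK : MemLp K 4 P) :
    Integrable (fun ω => centeredSq P J ω * centeredSq P K ω) P ∧
    ∫ ω, centeredSq P J ω * centeredSq P K ω ∂P
      = ∫ ω, J ω ^ 2 * K ω ^ 2 ∂P - (∫ ω, J ω ^ 2 ∂P) * ∫ ω, K ω ^ 2 ∂P := by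
  set A := ∫ ω, J ω ^ 2 ∂P with hA
  set B := ∫ ω, K ω ^ 2 ∂P with hB
  have iJ := hJ.integrable_pow_le (k := 2) (by norm_num)
  have iK := hK.integrable_pow_le (k := 2) (by norm_num)
  have iJK := hJ.integrable_sq_mul_sq hK
  have h : ∀ ω, centeredSq P J ω * centeredSq P K ω
      = J ω ^ 2 * K ω ^ 2 - B * J ω ^ 2 - A * K ω ^ 2 + A * B := fun ω => by
    simp only [centeredSq, ← hA, ← hB]; ring
  have i1 : Integrable (fun ω => J ω ^ 2 * K ω ^ 2 - B * J ω ^ 2) P := iJK.sub (iJ.const_mul B)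
  have i2 : Integrable (fun ω => J ω ^ 2 * K ω ^ 2 - B * J ω ^ 2 - A * K ω ^ 2) P :=
    i1.sub (iK.const_mul A)
  simp only [h]
  refine ⟨i2.add (integrable_const _), ?_⟩
  rw [integral_add i2 (integrable_const _), integral_sub i1 (iK.const_mul A),
    integral_sub iJK (iJ.const_mul B), integral_const_mul, integral_const_mul, ← hA, ← hB]
  simp
  ring

/-- Expanded in monomials, `M*` has nonnegative coefficients that dominate those of both left-hand
sides term by term. -/
lemma le_MStar {ρ₁ ρ₂ lam m₄ : ℝ} (hlam : 0 ≤ lam) (hm : 0 ≤ m₄) :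
    64 * (ρ₁ ^ 2 + lam * ρ₂ ^ 2) ^ 2 ≤ MStar ρ₁ ρ₂ lam m₄ ∧
    16 * (lam * ρ₂ ^ 4 * m₄) ≤ MStar ρ₁ ρ₂ lam m₄ := by
  have e : MStar ρ₁ ρ₂ lam m₄ = 404 * ρ₁ ^ 4 + 456 * (lam * ρ₁ ^ 2 * ρ₂ ^ 2)
      + 91 * (lam ^ 2 * ρ₂ ^ 4) + 4 * ρ₁ ^ 2 + 356 * (lam * ρ₂ ^ 2) + 21 * (lam * ρ₂ ^ 4 * m₄) := by
    simp only [MStar, DOne, DTwo, lamTwo, rhoStar]; ring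
  have h1 : 0 ≤ ρ₁ ^ 4 := by positivity
  have h2 : 0 ≤ lam * ρ₁ ^ 2 * ρ₂ ^ 2 := by positivity
  have h3 : 0 ≤ lam ^ 2 * ρ₂ ^ 4 := by positivity
  have h4 : 0 ≤ lam * ρ₂ ^ 4 * m₄ := by positivity
  have h5 : 0 ≤ ρ₁ ^ 2 := by positivity
  have h6 : 0 ≤ lam * ρ₂ ^ 2 := by positivity
  rw [e]
  constructor
  · nlinarith
  · linarith

theorem mainTheorem7 {Ω : Type*} [MeasurableSpace Ω] (P : Measure Ω) [IsProbabilityMeasure P]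
    (a ρ₁ ρ₂ : ℝ) (lam : ℝ≥0)
    (w : ℝ≥0 → Ω → ℝ) (N : ℝ≥0 → Ω → ℕ) (Y : ℕ → Ω → ℝ) (ξ : ℝ≥0 → Ω → ℝ)
    (hξ : IsOUNoise P a ρ₁ ρ₂ lam w N Y ξ)
    (n : ℝ≥0) (hn : 0 < n)
    (f g : ℝ≥0 → ℝ)
    (hf_bdd : ∃ C : ℝ, ∀ t, |f t| ≤ C) (hg_bdd : ∃ C : ℝ, ∀ t, |g t| ≤ C)
    (hf : ∀ t, ContinuousWithinAt f (Set.Iic t) t)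
    (hg : ∀ t, ContinuousWithinAt g (Set.Iic t) t) :
    (∃ If : Ω → ℝ, IsStochIntegral P ξ f n If) ∧
    (∃ Ig : Ω → ℝ, IsStochIntegral P ξ g n Ig) ∧
    ∀ If Ig : Ω → ℝ, IsStochIntegral P ξ f n If → IsStochIntegral P ξ g n Ig →
      Integrable (fun ω => If ω ^ 2) P ∧ Integrable (fun ω => Ig ω ^ 2) P ∧
      Integrable (fun ω => centeredSq P If ω * centeredSq P Ig ω) P ∧
      |∫ ω, centeredSq P If ω * centeredSq P Ig ω ∂P| ≤
        (n : ℝ) * MStar ρ₁ ρ₂ lam (∫ ω, Y 0 ω ^ 4 ∂P) *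
          (corrStar n f g + starNorm n f * starNorm n g) * (starNorm n f * starNorm n g) := by
  have af : IsAdmissible n f := ⟨hf_bdd.imp fun C hC t _ => hC t, fun t _ => hf t⟩
  have ag : IsAdmissible n g := ⟨hg_bdd.imp fun C hC t _ => hC t, fun t _ => hg t⟩
  have ha := hξ.a_nonpos
  have hu := hξ.hasStepMoments
  have hex : ∀ {φ : ℝ≥0 → ℝ}, IsAdmissible n φ → ∃ J : Ω → ℝ, IsStochIntegral P ξ φ n J := by
    intro φ hφ
    obtain ⟨J, hJ⟩ := hu.exists_isL4Integral (hφ.volterra ha)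
    exact ⟨J, (hξ.isStochIntegral_iff hφ J).2 (hJ.isStochIntegral hu)⟩
  refine ⟨hex af, hex ag, fun If Ig hIf hIg => ?_⟩
  have hJ := hξ.isL4Integral_of_isStochIntegral af hIf
  have hK := hξ.isL4Integral_of_isStochIntegral ag hIg
  obtain ⟨hint, hval⟩ := integral_centeredSq_mul hJ.memLp hK.memLp
  refine ⟨hJ.memLp.integrable_pow_le (by norm_num), hK.memLp.integrable_pow_le (by norm_num),
    hint, ?_⟩
  rw [hval, IsL4Integral.integral_sq_mul_sq hu (af.volterra ha) (ag.volterra ha) hJ hK]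
  set F := volterra a n f with hF
  set G := volterra a n g with hG
  set m₄ := ∫ ω, Y 0 ω ^ 4 ∂P with hm₄
  have hm0 : 0 ≤ m₄ := integral_nonneg fun ω => (show Even 4 by decide).pow_nonneg _
  set q := ρ₁ ^ 2 + (lam : ℝ) * ρ₂ ^ 2 with hq
  set κ := (lam : ℝ) * ρ₂ ^ 4 * m₄ with hκ
  have hκ0 : 0 ≤ κ := by positivity
  set c := corrStar n f g with hc
  set x := starNorm n f with hx
  set y := starNorm n g with hy
  have hx0 : 0 ≤ x := (abs_nonneg _).trans (af.abs_le_starNorm (zero_le (a := n)))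
  have hy0 : 0 ≤ y := (abs_nonneg _).trans (ag.abs_le_starNorm (zero_le (a := n)))
  have hFx : ∀ t ∈ Set.Ioc (0 : ℝ) n, |F t.toNNReal| ≤ 2 * x := fun t ht =>
    abs_volterra_le ha (fun s hs => af.abs_le_starNorm hs) _ (toNNReal_le_of_mem_Ioc ht)
  have hGy : ∀ t ∈ Set.Ioc (0 : ℝ) n, |G t.toNNReal| ≤ 2 * y := fun t ht =>
    abs_volterra_le ha (fun s hs => ag.abs_le_starNorm hs) _ (toNNReal_le_of_mem_Ioc ht)
  have hFG : ∀ t ∈ Set.Ioc (0 : ℝ) n, |F t.toNNReal * G t.toNNReal| ≤ 4 * (x * y) := by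
    intro t ht
    rw [abs_mul]
    calc |F t.toNNReal| * |G t.toNNReal| ≤ (2 * x) * (2 * y) :=
          mul_le_mul (hFx t ht) (hGy t ht) (abs_nonneg _) (by positivity)
      _ = 4 * (x * y) := by ring
  set I := ∫ t in Set.Ioc (0 : ℝ) n, F t.toNNReal * G t.toNNReal with hI
  set I₂ := ∫ t in Set.Ioc (0 : ℝ) n, F t.toNNReal ^ 2 * G t.toNNReal ^ 2 with hI₂
  have hI1 : |I| ≤ 8 * c := abs_integral_volterra_mul_volterra_le ha af ag
  have hI2 : |I| ≤ 4 * (x * y) * n := abs_setIntegral_le_const_mul hFG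
  have hI3 : |I₂| ≤ 16 * (x * y) ^ 2 * n := by
    refine abs_setIntegral_le_const_mul fun t ht => ?_
    rw [← mul_pow, abs_pow]
    calc |F t.toNNReal * G t.toNNReal| ^ 2 ≤ (4 * (x * y)) ^ 2 :=
          pow_le_pow_left₀ (abs_nonneg _) (hFG t ht) 2
      _ = 16 * (x * y) ^ 2 := by ring
  -- Nonnegativity of the correlation is read off from the bound it provides.
  have hc0 : 0 ≤ c := by linarith [abs_nonneg I]
  -- Bounding both factors by the trivial estimate would give `n²`; using the correlation for one of
  -- them keeps the estimate linear in `n` apart from `c`.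
  have hI4 : I ^ 2 ≤ (8 * c) * (4 * (x * y) * n) := by
    rw [← sq_abs, sq]
    exact mul_le_mul hI1 hI2 (abs_nonneg _) (by positivity)
  obtain ⟨hM1, hM2⟩ := le_MStar (ρ₁ := ρ₁) (ρ₂ := ρ₂) (lam := lam) lam.coe_nonneg hm0
  set M := MStar ρ₁ ρ₂ lam m₄ with hM
  have e : (∫ ω, If ω ^ 2 ∂P) * (∫ ω, Ig ω ^ 2 ∂P) + 2 * (q * I) ^ 2 + κ * I₂
      - (∫ ω, If ω ^ 2 ∂P) * (∫ ω, Ig ω ^ 2 ∂P) = 2 * (q ^ 2 * I ^ 2) + κ * I₂ := by ring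
  rw [e]
  have hxyn : 0 ≤ x * y * n := by positivity
  calc |2 * (q ^ 2 * I ^ 2) + κ * I₂| ≤ |2 * (q ^ 2 * I ^ 2)| + |κ * I₂| := abs_add_le _ _
    _ = 2 * (q ^ 2 * I ^ 2) + κ * |I₂| := by
        rw [abs_of_nonneg (by positivity), abs_mul, abs_of_nonneg hκ0]
    _ ≤ 2 * (q ^ 2 * ((8 * c) * (4 * (x * y) * n))) + κ * (16 * (x * y) ^ 2 * n) := by
        gcongr
    -- Here `64 = 2 · 8 · 4`, and `16` is the square of the constant in `|F G| ≤ 4 x y`.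
    _ = (64 * q ^ 2) * (c * (x * y * n)) + (16 * κ) * (x * y * (x * y * n)) := by ring
    _ ≤ M * (c * (x * y * n)) + M * (x * y * (x * y * n)) := by
        gcongr
    _ = n * M * (c + x * y) * (x * y) := by ring
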